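/- **Setting.** Let $\mathbb E,\mathbb A,\mathbb B$ be Borel spaces (Borel subsets of Polish spaces): the state space and the action spaces of players 1 and 2. For $x\in\mathbb E$ let $\mathbb A_x\subset\mathbb A$ and $\mathbb B_x\subset\mathbb B$ be the sets of admissible actions; the graphs $\{(x,a):a\in\mathbb A_x\}$, $\{(x,b):b\in\mathbb B_x\}$ are measurable and contain the graphs of measurable maps $\mathbb E\to\mathbb A$, $\mathbb E\to\mathbb B$. Let $Q$ be a transition (probability) kernel from $\mathbb E\times\mathbb A\times\mathbb B$ to $\mathbb E$, $r:\mathbb E\times\mathbb A\times\mathbb B\to\mathbb R$ measurable with $0\le r\le\bar r$, $\beta\in(0,1)$ and $\bar\gamma>0$. Assume: - (A1) all $\mathbb A_x,\mathbb B_x$ are compact; - (A2) $x\mapsto\mathbb A_x$ is continuous, i.e. $\{x:\mathbb A_x\cap C\ne\emptyset\}$ is closed for every closed $C\subset\mathbb A$ and $\{x:\mathbb A_x\cap D\neq\emptyset\}$ is open for every open $D\subset\mathbb A$; likewise $x\mapsto\mathbb B_x$; - (A3) $r$ is continuous; - (A4) $(x,a,b)\mapsto\int v(x')\,Q(dx'|x,a,b)$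 is continuous for every bounded continuous $v:\mathbb E\to\mathbb R$. Let $\mathbb P(\mathbb A_x)$ be the set of probability measures on $\mathbb A$ concentrated on $\mathbb A_x$; $\mathbb P(\mathbb A)$ carries the weak topology and its Borel $\sigma$-algebra; similarly for $\mathbb B$. A decision rule of player 1 is a measurable $f:\mathbb E\to\mathbb P(\mathbb A)$ with $f(x)\in\mathbb P(\mathbb A_x)$ for all $x$; a (randomized Markov) policy is a sequence $\pi=(f_n)_{n\ge0}$ of decision rules. Decision rules $g$ and policies $\sigma=(g_n)_{n\ge0}$ of player 2 are defined in the same way. Policies $\pi,\sigma$ and $x\in\mathbb E$ define a law $\mathrm P_x^{\pi\sigma}$ of a process $(X_n,A_n,B_n)_{n\ge0}$ with $X_0=x$, where given the past and $X_n$ the actions $A_n\sim f_n(X_n)$, $B_n\sim g_n(X_n)$ are independent, and $X_{n+1}\sim Q(\cdot|X_n,A_n,B_n)$. For $\gamma\in(0,\bar\gamma]$ and $N\in\mathbb N_0\cup\{\infty\}$ put $$V_{N\pi\sigma}(x,\gamma)=\mathrm E_x^{\pi\sigma}\Big[\exp\Big(\gamma\sum_{0\le k<N}\beta^k r(X_k,A_k,B_k)\Big)\Big],\qquad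 V_N(x,\gamma)=\inf_\sigma\sup_\pi V_{N\pi\sigma}(x,\gamma).$$ Let $\tilde Q(dx'|x,\gamma,a,b)=e^{\gamma r(x,a,b)}Q(dx'|x,a,b)$ and $\tilde Q(dx'|x,\gamma,\mu,\nu)=\iint\tilde Q(dx'|x,\gamma,a,b)\,\mu(da)\,\nu(db)$. For $v:\mathbb E\times(0,\bar\gamma]\to\mathbb R$ measurable and bounded put $$Lv(x,\gamma,\mu,\nu)=\int v(x',\beta\gamma)\,\tilde Q(dx'|x,\gamma,\mu,\nu),\qquad Tv(x,\gamma)=\inf_g\sup_f Lv(x,\gamma,f(x),g(x)),$$ with $f,g$ ranging over the decision rules of players 1 and 2. **Theorem.** Under these assumptions: a) $V_N\to V_\infty$ uniformly on $\mathbb E\times(0,\bar\gamma]$ as $N\to\infty$. The function $V_\infty$ is continuous, satisfies $1\le V_\infty(x,\gamma)\le e^{\gamma\bar r/(1-\beta)}$, and solves the Shapley equation $$V_\infty(x,\gamma)=TV_\infty(x,\gamma)=\inf_{\nu\in\mathbb P(\mathbb B_x)}\sup_{\mu\in\mathbb P(\mathbb A_x)}\int V_\infty(x',\beta\gamma)\,\tilde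 Q(dx'|x,\gamma,\mu,\nu).$$ It is the only continuous $v:\mathbb E\times(0,\bar\gamma]\to\mathbb R$ with $v=Tv$ and $1\le v(x,\gamma)\le e^{\gamma\bar r/(1-\beta)}$ for all $(x,\gamma)$. b) There are measurable maps $\mu^*:\mathbb E\times(0,\bar\gamma]\to\mathbb P(\mathbb A)$ and $\nu^*:\mathbb E\times(0,\bar\gamma]\to\mathbb P(\mathbb B)$ with $\mu^*(x,\gamma)\in\mathbb P(\mathbb A_x)$, $\nu^*(x,\gamma)\in\mathbb P(\mathbb B_x)$ such that, for every $(x,\gamma)$, the pair $(\mu^*(x,\gamma),\nu^*(x,\gamma))$ is a saddle point of $LV_\infty(x,\gamma,\cdot,\cdot)$ on $\mathbb P(\mathbb A_x)\times\mathbb P(\mathbb B_x)$, i.e. for all $\mu\in\mathbb P(\mathbb A_x)$, $\nu\in\mathbb P(\mathbb B_x)$ $$LV_\infty(x,\gamma,\mu,\nu^*(x,\gamma))\le LV_\infty(x,\gamma,\mu^*(x,\gamma),\nu^*(x,\gamma))\le LV_\infty(x,\gamma,\mu^*(x,\gamma),\nu).$$ $V_\infty$ is the value of the infinite horizon game: $V_\infty=\inf_\sigma\sup_\pi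 V_{\infty\pi\sigma}=\sup_\pi\inf_\sigma V_{\infty\pi\sigma}$. For any such $(\mu^*,\nu^*)$ and every $\gamma\in(0,\bar\gamma]$, the policies $\pi^*=(f_n^*)_{n\ge0}$, $\sigma^*=(g_n^*)_{n\ge0}$ with $f_n^*(x)=\mu^*(x,\gamma\beta^n)$, $g_n^*(x)=\nu^*(x,\gamma\beta^n)$ are optimal, i.e. for all $x$, $\pi$, $\sigma$ $$V_{\infty\pi^*\sigma}(x,\gamma)\ge\sup_{\pi'}\inf_{\sigma'}V_{\infty\pi'\sigma'}(x,\gamma),\qquad V_{\infty\pi\sigma^*}(x,\gamma)\le\inf_{\sigma'}\sup_{\pi'}V_{\infty\pi'\sigma'}(x,\gamma).$$ -/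

import Mathlib

open MeasureTheory ProbabilityTheory Set Filter Topology

/-- The probability measures on `A` that are concentrated on the set `s`, i.e. `ℙ(s)`. -/
def probOn {A : Type*} [MeasurableSpace A] (s : Set A) : Set (ProbabilityMeasure A) :=
  {μ | (μ : Measure A) sᶜ = 0}

/-- Randomized decision rules: measurable maps `f : E → ℙ(A)` with `f x ∈ ℙ(act x)` for all `x`.
The σ-algebra on `ProbabilityMeasure A` is the one generated by the evaluations `μ ↦ μ S`; for a
separable metrizable `A` it is the Borel σ-algebra of the weak topology. -/
def DecisionRule {E A : Type*} [MeasurableSpace E] [MeasurableSpace A] (act : E → Set A) :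
    Type _ :=
  {f : E → ProbabilityMeasure A // Measurable f ∧ ∀ x, f x ∈ probOn (act x)}

/-- Randomized Markovian policies: sequences of decision rules. -/
abbrev Policy {E A : Type*} [MeasurableSpace E] [MeasurableSpace A] (act : E → Set A) : Type _ :=
  ℕ → DecisionRule act

/-- A decision rule, seen as a transition kernel. -/
def DecisionRule.kernel {E A : Type*} [MeasurableSpace E] [MeasurableSpace A] {act : E → Set A}
    (f : DecisionRule act) : Kernel E A where
  toFun x := (f.1 x : Measure A)
  measurable' := measurable_subtype_coe.comp f.2.1

instance {E A : Type*} [MeasurableSpace E] [MeasurableSpace A] {act : E → Set A}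
    (f : DecisionRule act) : IsMarkovKernel f.kernel :=
  ⟨fun x => inferInstanceAs (IsProbabilityMeasure (f.1 x : Measure A))⟩

/-- `(c, d)` is a saddle point of `φ` on `S × T`, the first variable being the maximizer's. -/
def IsSaddle {M N : Type*} (S : Set M) (T : Set N) (φ : M → N → ℝ) (c : M) (d : N) : Prop :=
  c ∈ S ∧ d ∈ T ∧ (∀ μ ∈ S, φ μ d ≤ φ c d) ∧ (∀ ν ∈ T, φ c d ≤ φ c ν)

/-- Data of a two-person zero-sum stochastic game with state space `E` and action spaces `A`, `B`
(player 1 chooses in `A` and maximizes), discount factor `β ∈ (0,1]` and range `(0, γbar]` for the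
risk-sensitivity parameter. -/
structure RSGame (E A B : Type*) [MeasurableSpace E] [MeasurableSpace A] [MeasurableSpace B] where
  /-- admissible actions of player 1 -/
  actA : E → Set A
  /-- admissible actions of player 2 -/
  actB : E → Set B
  measurableSet_graphA : MeasurableSet {p : E × A | p.2 ∈ actA p.1}
  measurableSet_graphB : MeasurableSet {p : E × B | p.2 ∈ actB p.1}
  exists_selectorA : ∃ s : E → A, Measurable s ∧ ∀ x, s x ∈ actA x
  exists_selectorB : ∃ s : E → B, Measurable s ∧ ∀ x, s x ∈ actB x
  /-- transition kernel -/
  Q : Kernel (E × A × B) E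
  isMarkovKernel_Q : IsMarkovKernel Q
  /-- one-stage reward of player 1 -/
  r : E × A × B → ℝ
  /-- upper bound of the reward -/
  rbar : ℝ
  measurable_r : Measurable r
  r_nonneg : ∀ p, 0 ≤ r p
  r_le : ∀ p, r p ≤ rbar
  /-- discount factor -/
  β : ℝ
  β_pos : 0 < β
  β_le_one : β ≤ 1
  /-- largest risk-sensitivity parameter -/
  γbar : ℝ
  γbar_pos : 0 < γbar

/-- Continuity of a correspondence: upper and lower semicontinuity. -/
def ContinuousCorrespondence {E A : Type*} [TopologicalSpace E] [TopologicalSpace A]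
    (act : E → Set A) : Prop :=
  (∀ C : Set A, IsClosed C → IsClosed {x | (act x ∩ C).Nonempty}) ∧
  (∀ D : Set A, IsOpen D → IsOpen {x | (act x ∩ D).Nonempty})

namespace RSGame

/-- The continuity and compactness assumptions on the game. -/
structure ContinuityCompactness {E A B : Type*}
    [TopologicalSpace E] [MeasurableSpace E] [TopologicalSpace A] [MeasurableSpace A]
    [TopologicalSpace B] [MeasurableSpace B] (G : RSGame E A B) : Prop where
  isCompact_actA : ∀ x, IsCompact (G.actA x)
  isCompact_actB : ∀ x, IsCompact (G.actB x)
  continuous_actA : ContinuousCorrespondence G.actA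
  continuous_actB : ContinuousCorrespondence G.actB
  continuous_r : Continuous G.r
  weaklyContinuous_Q : ∀ v : BoundedContinuousFunction E ℝ,
    Continuous fun p : E × A × B => ∫ x', v x' ∂(G.Q p)

section

variable {E A B : Type*} [MeasurableSpace E] [MeasurableSpace A] [MeasurableSpace B]

instance (G : RSGame E A B) : IsMarkovKernel G.Q := G.isMarkovKernel_Q

/-- The parameter `γ βⁿ`, as an element of `(0, γbar]`. -/
def discount (G : RSGame E A B) (n : ℕ) (γ : Ioc (0 : ℝ) G.γbar) : Ioc (0 : ℝ) G.γbar :=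
  ⟨γ * G.β ^ n, mul_pos γ.2.1 (pow_pos G.β_pos n),
    (mul_le_of_le_one_right γ.2.1.le (pow_le_one₀ G.β_pos.le G.β_le_one)).trans γ.2.2⟩

/-- The kernel `x ↦ δ_x ⊗ f(x) ⊗ g(x)`: in state `x` the players draw their actions independently
from `f x` and `g x`. -/
noncomputable def stageKernel (G : RSGame E A B) (f : DecisionRule G.actA)
    (g : DecisionRule G.actB) : Kernel E (E × A × B) :=
  Kernel.id ×ₖ (f.kernel ×ₖ g.kernel)

instance (G : RSGame E A B) (f : DecisionRule G.actA) (g : DecisionRule G.actB) :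
    IsMarkovKernel (G.stageKernel f g) := by
  unfold stageKernel; infer_instance

/-- The conditional law of `(X_{n+1}, A_{n+1}, B_{n+1})` given `(X_k, A_k, B_k)`, `k ≤ n`: the state
is drawn from `Q(· | X_n, A_n, B_n)`, then the actions from the decision rules of stage `n+1`. -/
noncomputable def stepKernel (G : RSGame E A B) (π : Policy G.actA) (σ : Policy G.actB) (n : ℕ) :
    Kernel (Π _ : Finset.Iic n, E × A × B) (E × A × B) :=
  G.stageKernel (π (n + 1)) (σ (n + 1)) ∘ₖ
    G.Q.comap (fun h => h ⟨n, Finset.mem_Iic.2 le_rfl⟩) (measurable_pi_apply _)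

instance (G : RSGame E A B) (π : Policy G.actA) (σ : Policy G.actB) (n : ℕ) :
    IsMarkovKernel (G.stepKernel π σ n) := by
  unfold stepKernel; infer_instance

/-- The law `P_x^{πσ}` on `(E × A × B)^ℕ` of the process `(X_n, A_n, B_n)` started in `X_0 = x`,
given by the Ionescu-Tulcea theorem. -/
noncomputable def law (G : RSGame E A B) (π : Policy G.actA) (σ : Policy G.actB) (x : E) :
    Measure (ℕ → E × A × B) :=
  Kernel.trajMeasure (X := fun _ => E × A × B) (G.stageKernel (π 0) (σ 0) x) (G.stepKernel π σ)

/-- `V_{Nπσ}(x,γ)`: expected exponential utility of the `N`-stage discounted reward. -/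
noncomputable def payoff (G : RSGame E A B) (N : ℕ) (π : Policy G.actA) (σ : Policy G.actB)
    (p : E × Ioc (0 : ℝ) G.γbar) : ℝ :=
  ∫ ω, Real.exp (p.2 * ∑ k ∈ Finset.range N, G.β ^ k * G.r (ω k)) ∂(G.law π σ p.1)

/-- `V_{∞πσ}(x,γ)`: expected exponential utility of the total discounted reward (for `β < 1`). -/
noncomputable def payoffInf (G : RSGame E A B) (π : Policy G.actA) (σ : Policy G.actB)
    (p : E × Ioc (0 : ℝ) G.γbar) : ℝ :=
  ∫ ω, Real.exp (p.2 * ∑' k : ℕ, G.β ^ k * G.r (ω k)) ∂(G.law π σ p.1)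

/-- The upper value `V_N` of the `N`-stage game. -/
noncomputable def upperValue (G : RSGame E A B) (N : ℕ) (p : E × Ioc (0 : ℝ) G.γbar) : ℝ :=
  ⨅ σ : Policy G.actB, ⨆ π : Policy G.actA, G.payoff N π σ p

/-- The upper value `V_∞` of the infinite horizon game. -/
noncomputable def upperValueInf (G : RSGame E A B) (p : E × Ioc (0 : ℝ) G.γbar) : ℝ :=
  ⨅ σ : Policy G.actB, ⨆ π : Policy G.actA, G.payoffInf π σ p

/-- The lower value of the infinite horizon game. -/
noncomputable def lowerValueInf (G : RSGame E A B) (p : E × Ioc (0 : ℝ) G.γbar) : ℝ :=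
  ⨆ π : Policy G.actA, ⨅ σ : Policy G.actB, G.payoffInf π σ p

/-- `π` is optimal for player 1 in the infinite horizon game with parameter `γ`. -/
def IsOptimal₁ (G : RSGame E A B) (γ : Ioc (0 : ℝ) G.γbar) (π : Policy G.actA) : Prop :=
  ∀ (x : E) (σ : Policy G.actB), G.lowerValueInf (x, γ) ≤ G.payoffInf π σ (x, γ)

/-- `σ` is optimal for player 2 in the infinite horizon game with parameter `γ`. -/
def IsOptimal₂ (G : RSGame E A B) (γ : Ioc (0 : ℝ) G.γbar) (σ : Policy G.actB) : Prop :=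
  ∀ (x : E) (π : Policy G.actA), G.payoffInf π σ (x, γ) ≤ G.upperValueInf (x, γ)

/-- The transition measure `Q̃(dx' | x,γ,a,b) = exp(γ r(x,a,b)) Q(dx' | x,a,b)`. -/
noncomputable def Qtilde (G : RSGame E A B) (x : E) (γ : ℝ) (a : A) (b : B) : Measure E :=
  ENNReal.ofReal (Real.exp (γ * G.r (x, a, b))) • G.Q (x, a, b)

/-- `Q̃(dx' | x,γ,μ,ν) = ∫∫ Q̃(dx' | x,γ,a,b) μ(da) ν(db)`. -/
noncomputable def QtildeMixed (G : RSGame E A B) (x : E) (γ : ℝ) (μ : ProbabilityMeasure A)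
    (ν : ProbabilityMeasure B) : Measure E :=
  ((μ : Measure A).prod (ν : Measure B)).bind fun c => G.Qtilde x γ c.1 c.2

/-- `(Lv)(x,γ,μ,ν) = ∫ v(x', βγ) Q̃(dx' | x,γ,μ,ν)`. -/
noncomputable def L (G : RSGame E A B) (v : E × Ioc (0 : ℝ) G.γbar → ℝ)
    (p : E × Ioc (0 : ℝ) G.γbar) (μ : ProbabilityMeasure A) (ν : ProbabilityMeasure B) : ℝ :=
  ∫ x', v (x', G.discount 1 p.2) ∂(G.QtildeMixed p.1 p.2 μ ν)

/-- The operator `(Tv)(x,γ) = inf_g sup_f ∫ v(x', βγ) Q̃(dx' | x,γ,f(x),g(x))`. -/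
noncomputable def T (G : RSGame E A B) (v : E × Ioc (0 : ℝ) G.γbar → ℝ)
    (p : E × Ioc (0 : ℝ) G.γbar) : ℝ :=
  ⨅ g : DecisionRule G.actB, ⨆ f : DecisionRule G.actA, G.L v p (f.1 p.1) (g.1 p.1)

/-- Admissible measurable selectors `μ : E × (0, γbar] → ℙ(A)`, `μ(x,γ) ∈ ℙ(A_x)`. -/
abbrev Selector {A : Type*} [MeasurableSpace A] (γbar : ℝ) (act : E → Set A) : Type _ :=
  DecisionRule fun p : E × Ioc (0 : ℝ) γbar => act p.1

/-- The policy `f_n(x) = μ(x, γ βⁿ)` of player 1. -/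
def policyA (G : RSGame E A B) (μ : Selector G.γbar G.actA) (γ : Ioc (0 : ℝ) G.γbar) :
    Policy G.actA := fun n =>
  ⟨fun x => μ.1 (x, G.discount n γ), μ.2.1.comp measurable_prodMk_right, fun _ => μ.2.2 _⟩

/-- The policy `g_n(x) = ν(x, γ βⁿ)` of player 2. -/
def policyB (G : RSGame E A B) (ν : Selector G.γbar G.actB) (γ : Ioc (0 : ℝ) G.γbar) :
    Policy G.actB := fun n =>
  ⟨fun x => ν.1 (x, G.discount n γ), ν.2.1.comp measurable_prodMk_right, fun _ => ν.2.2 _⟩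

/-- `(μ(x,γ), ν(x,γ))` is, for every `(x,γ)`, a saddle point of `Lv(x,γ,·,·)` on
`ℙ(A_x) × ℙ(B_x)`. -/
def IsSaddleSelector (G : RSGame E A B) (v : E × Ioc (0 : ℝ) G.γbar → ℝ)
    (μ : Selector G.γbar G.actA) (ν : Selector G.γbar G.actB) : Prop :=
  ∀ p, IsSaddle (probOn (G.actA p.1)) (probOn (G.actB p.1)) (G.L v p) (μ.1 p) (ν.1 p)

end

end RSGame

/-!
The solution of the Shapley equation is found first, and only then recognised as the value of the
infinite horizon game.

For bounded continuous `v` the one-stage game has the jointly continuous payoff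
`u(x,γ,a,b) = exp(γ r(x,a,b)) ∫ v(x',βγ) Q(dx'|x,a,b)`, and `L v` is its mixed extension
(`RSGame.L_eq_mixedPayoff`). Since the sets `ℙ(A_x)` and `ℙ(B_x)` are weakly compact, Sion's theorem
gives saddle points (`exists_isSaddle_probOn`), and the value depends continuously on `(x,γ)`
(`continuous_mixedValue`). The sets of optimal mixed actions are compact and depend upper
hemicontinuously on `(x,γ)`, so they admit measurable selections: maximising successively the
members of a sequence of weakly continuous functions that separates measures leaves a single point
(`exists_measurable_selection`).

In terms of the certainty equivalent `h`, where `v = exp(γ h)`, the operator `T` becomes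
`h ↦ γ⁻¹ log T(exp(γ h))`. It is monotone, and replacing `h` by `h + d` multiplies the continuation,
which is evaluated at the parameter `βγ`, by `exp(βγd)`. Hence it is a `β`-contraction for the sup
norm (`RSGame.contracting_logShapley`), which yields a continuous solution `v` of `v = T v` within
the bounds (`RSGame.exists_T_eq_self`).

Now let `v = T v` within the bounds, and let the players use one-stage saddle points at the
parameters `γβⁿ`. Under the saddle policy of player 2, the expectation of
`exp(γ ∑_{k<n} βᵏ r_k) v(X_n, γβⁿ)` is nonincreasing in `n`; under that of player 1 it is
nondecreasing; it starts at `v(x,γ)` (`RSGame.continuation_zero`, `RSGame.continuation_succ`).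
Because `1 ≤ v(·,γβⁿ) ≤ exp(γβⁿ rbar/(1-β))`, its limit is the payoff. So the saddle policies form a
saddle point of the infinite horizon game with value `v(x,γ)`
(`RSGame.IsSaddleSelector.isSaddle_payoffInf`). This gives the existence and the uniqueness of the
value together with the optimality of the policies. Finally, truncation after `N` stages changes
all payoffs by a factor in `[1, exp(γβᴺ rbar/(1-β))]`, which gives the uniform convergence of the
finite horizon values (`RSGame.tendstoUniformly_upperValue`).
-/

set_option linter.unusedSectionVars false

/-! ### Measurable selection from compact-valued correspondences -/

/-- Selection of a point from each value of a compact-valued correspondence: maximise the functions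
`h 0, h 1, …` successively. Each maximisation step keeps the correspondence measurable, and since
the sequence separates points, exactly one point survives all steps. -/
theorem exists_measurable_selection {Ω Y : Type*} [MeasurableSpace Ω] [TopologicalSpace Y]
    [T2Space Y] (O : Ω → Set Y) (hne : ∀ ω, (O ω).Nonempty) (hcpt : ∀ ω, IsCompact (O ω))
    (hmeas : ∀ C, IsClosed C → MeasurableSet {ω | (O ω ∩ C).Nonempty})
    (h : ℕ → Y → ℝ) (hcont : ∀ k, Continuous (h k))
    (hsep : ∀ y z, (∀ k, h k y = h k z) → y = z) :
    ∃ s : Ω → Y, (∀ ω, s ω ∈ O ω) ∧ ∀ C, IsClosed C → MeasurableSet (s ⁻¹' C) := by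
  let S : (Ω → Set Y) → ℕ → Ω → Set Y := fun O k ω =>
    {y | y ∈ O ω ∧ ∀ z ∈ O ω, h k z ≤ h k y}
  let P : (Ω → Set Y) → Prop := fun O => (∀ ω, (O ω).Nonempty) ∧ (∀ ω, IsCompact (O ω)) ∧
    ∀ C, IsClosed C → MeasurableSet {ω | (O ω ∩ C).Nonempty}
  have hS : ∀ O k, P O → P (S O k) := by
    rintro O k ⟨h1, h2, h3⟩
    have hmax : ∀ ω, ∃ y ∈ O ω, ∀ z ∈ O ω, h k z ≤ h k y := fun ω =>
      (h2 ω).exists_isMaxOn (h1 ω) (hcont k).continuousOn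
    refine ⟨fun ω => ?_, fun ω => ?_, fun C hC => ?_⟩
    · obtain ⟨y, hy, hy'⟩ := hmax ω
      exact ⟨y, hy, hy'⟩
    · have : S O k ω = O ω ∩ ⋂ z ∈ O ω, {y | h k z ≤ h k y} := by
        ext y; simp [S]
      rw [this]
      exact (h2 ω).inter_right (isClosed_biInter fun z _ => isClosed_le continuous_const (hcont k))
    · -- `S O k` meets `C` iff `O ∩ C` reaches every rational level of `h k` that `O` reaches
      have : {ω | (S O k ω ∩ C).Nonempty} = {ω | (O ω ∩ C).Nonempty} ∩ ⋂ t : ℚ,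
          ({ω | (O ω ∩ {y | (t : ℝ) ≤ h k y}).Nonempty}ᶜ ∪
            {ω | (O ω ∩ (C ∩ {y | (t : ℝ) ≤ h k y})).Nonempty}) := by
        ext ω
        simp only [mem_inter_iff, mem_iInter, mem_union, mem_compl_iff, mem_ofPred_eq]
        constructor
        · rintro ⟨y, ⟨hy, hmy⟩, hyC⟩
          refine ⟨⟨y, hy, hyC⟩, fun t => ?_⟩
          by_cases ht : (t : ℝ) ≤ h k y
          · exact Or.inr ⟨y, hy, hyC, ht⟩
          · refine Or.inl ?_
            rintro ⟨z, hz, hz'⟩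
            exact ht (le_trans hz' (hmy z hz))
        · rintro ⟨hC1, hC2⟩
          obtain ⟨y, hy, hmy⟩ := ((h2 ω).inter_right hC).exists_isMaxOn hC1 (hcont k).continuousOn
          refine ⟨y, ⟨hy.1, fun z hz => ?_⟩, hy.2⟩
          by_contra hlt
          obtain ⟨t, ht1, ht2⟩ := exists_rat_btwn (not_le.1 hlt)
          rcases hC2 t with h' | ⟨w, hw, hwC, hw'⟩
          · exact h' ⟨z, hz, ht2.le⟩
          · have := hmy ⟨hw, hwC⟩
            simp only [mem_ofPred_eq] at this hw'
            linarith
      rw [this]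
      refine (h3 C hC).inter (MeasurableSet.iInter fun t => ?_)
      have hcl : IsClosed {y | (t : ℝ) ≤ h k y} := isClosed_le continuous_const (hcont k)
      exact (h3 _ hcl).compl.union (h3 _ (hC.inter hcl))
  let seq : ℕ → Ω → Set Y := fun n => Nat.rec O (fun k O' => S O' k) n
  have hseq : ∀ n, P (seq n) := by
    intro n
    induction n with
    | zero => exact ⟨hne, hcpt, hmeas⟩
    | succ k ih => exact hS _ k ih
  have hanti : ∀ n ω, seq (n + 1) ω ⊆ seq n ω := fun n ω y hy => hy.1
  have hcap : ∀ (ω : Ω) (C : Set Y), IsClosed C → (∀ n, (seq n ω ∩ C).Nonempty) →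
      ((⋂ n, seq n ω) ∩ C).Nonempty := by
    intro ω C hC hn
    have := IsCompact.nonempty_iInter_of_sequence_nonempty_isCompact_isClosed
      (fun n => seq n ω ∩ C) (fun n => inter_subset_inter_left _ (hanti n ω)) hn
      (((hseq 0).2.1 ω).inter_right hC) (fun n => ((hseq n).2.1 ω).isClosed.inter hC)
    obtain ⟨y, hy⟩ := this
    rw [mem_iInter] at hy
    exact ⟨y, mem_iInter.2 fun n => (hy n).1, (hy 0).2⟩
  have hex : ∀ ω, ∃ y, y ∈ ⋂ n, seq n ω := fun ω => by
    obtain ⟨y, hy, -⟩ := hcap ω univ isClosed_univ (fun n => by simpa using (hseq n).1 ω)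
    exact ⟨y, hy⟩
  choose s hs using hex
  have huniq : ∀ ω y, y ∈ ⋂ n, seq n ω → y = s ω := by
    intro ω y hy
    have h1 := hs ω
    rw [mem_iInter] at hy h1
    refine hsep _ _ fun k => le_antisymm ?_ ?_
    · exact (h1 (k + 1)).2 y (hy k)
    · exact (hy (k + 1)).2 _ (h1 k)
  refine ⟨s, fun ω => mem_iInter.1 (hs ω) 0, fun C hC => ?_⟩
  have : s ⁻¹' C = ⋂ n, {ω | (seq n ω ∩ C).Nonempty} := by
    ext ω
    simp only [mem_preimage, mem_iInter, mem_ofPred_eq]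
    constructor
    · exact fun hω n => ⟨s ω, mem_iInter.1 (hs ω) n, hω⟩
    · intro hn
      obtain ⟨y, hy, hyC⟩ := hcap ω C hC hn
      rwa [← huniq ω y hy]
  rw [this]
  exact MeasurableSet.iInter fun n => (hseq n).2.2 C hC

/-- Countably many integrals of bounded continuous functions determine a probability measure:
approximate the indicators of the complements of finite unions of basic open sets, which form a
`π`-system of closed sets. -/
theorem exists_seq_continuous_separating (A : Type*) [TopologicalSpace A]
    [TopologicalSpace.MetrizableSpace A] [SecondCountableTopology A] [MeasurableSpace A]
    [BorelSpace A] :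
    ∃ h : ℕ → ProbabilityMeasure A → ℝ, (∀ k, Continuous (h k)) ∧
      ∀ μ ν, (∀ k, h k μ = h k ν) → μ = ν := by
  let _ := TopologicalSpace.metrizableSpaceMetric A
  let b := TopologicalSpace.countableBasis A
  have hb := TopologicalSpace.isBasis_countableBasis A
  have : Countable b := (TopologicalSpace.countable_countableBasis A).to_subtype
  let F : Finset b → Set A := fun t => ⋂ i ∈ t, ((i : Set A))ᶜ
  have hF : ∀ t, IsClosed (F t) := fun t =>
    isClosed_biInter fun i _ => (hb.isOpen i.2).isClosed_compl
  let f : Finset b × ℕ → BoundedContinuousFunction A NNReal := fun i => (hF i.1).apprSeq i.2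
  obtain ⟨e, he⟩ := exists_surjective_nat (Finset b × ℕ)
  refine ⟨fun k μ => (((∫⁻ x, f (e k) x ∂(μ : Measure A)).toNNReal : NNReal) : ℝ), fun k => ?_,
    fun μ ν hμν => ?_⟩
  · exact NNReal.continuous_coe.comp (ProbabilityMeasure.continuous_testAgainstNN_eval (f (e k)))
  · have hint : ∀ i, ∫⁻ x, f i x ∂(μ : Measure A) = ∫⁻ x, f i x ∂(ν : Measure A) := by
      intro i
      obtain ⟨k, rfl⟩ := he i
      have := NNReal.coe_injective (hμν k)
      rwa [ENNReal.toNNReal_eq_toNNReal_iff'] at this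
      · exact (BoundedContinuousFunction.lintegral_lt_top_of_nnreal _ _).ne
      · exact (BoundedContinuousFunction.lintegral_lt_top_of_nnreal _ _).ne
    have hFeq : ∀ t, (μ : Measure A) (F t) = (ν : Measure A) (F t) := by
      intro t
      have h2 := HasOuterApproxClosed.tendsto_lintegral_apprSeq (hF t) (μ : Measure A)
      have h3 := HasOuterApproxClosed.tendsto_lintegral_apprSeq (hF t) (ν : Measure A)
      refine tendsto_nhds_unique h2 (h3.congr fun n => ?_)
      exact (hint (t, n)).symm
    apply ProbabilityMeasure.toMeasure_injective
    refine ext_of_generate_finite (range F) ?_ ?_ ?_ ?_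
    · refine le_antisymm ?_ (MeasurableSpace.generateFrom_le ?_)
      · rw [‹BorelSpace A›.measurable_eq, hb.borel_eq_generateFrom]
        refine MeasurableSpace.generateFrom_le fun s hs => ?_
        have hsF : sᶜ = F {⟨s, hs⟩} := by
          ext x
          simp only [F, Finset.mem_singleton, mem_iInter, forall_eq]
        rw [← compl_compl s, hsF]
        exact (MeasurableSpace.measurableSet_generateFrom (mem_range_self _)).compl
      · rintro _ ⟨t, rfl⟩
        exact (hF t).measurableSet
    · classical
      rintro _ ⟨s, rfl⟩ _ ⟨t, rfl⟩ -
      refine ⟨s ∪ t, ?_⟩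
      simp only [F, Finset.mem_union, iInter_or, iInter_inter_distrib]
    · rintro _ ⟨t, rfl⟩
      exact hFeq t
    · simp

/-- A map into the probability measures that is Borel for the weak topology is measurable. -/
theorem measurable_probabilityMeasure_of_isClosed {Ω A : Type*} [MeasurableSpace Ω]
    [TopologicalSpace A] [TopologicalSpace.MetrizableSpace A] [SecondCountableTopology A]
    [MeasurableSpace A] [BorelSpace A] (s : Ω → ProbabilityMeasure A)
    (hs : ∀ C, IsClosed C → MeasurableSet (s ⁻¹' C)) : Measurable s := by
  let _ := TopologicalSpace.metrizableSpaceMetric A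
  refine Measurable.subtype_mk (f := fun ω => (s ω : Measure A)) ?_
  refine Measurable.measure_of_isPiSystem_of_isProbabilityMeasure
    (S := {F | IsClosed F}) ?_ ?_ ?_
  · rw [‹BorelSpace A›.measurable_eq, borel_eq_generateFrom_isClosed]
  · exact isPiSystem_isClosed
  · intro F hF
    refine measurable_of_Ici fun c => ?_
    -- upper level sets of `μ ↦ μ F` are weakly closed
    refine hs {μ | c ≤ (μ : Measure A) F} ?_
    refine IsSeqClosed.isClosed fun μ ν hμ hν => ?_
    refine le_trans ?_ (ProbabilityMeasure.limsup_measure_closed_le_of_tendsto hν hF)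
    exact le_limsup_of_frequently_le (Frequently.of_forall hμ) (by isBoundedDefault)

/-! ### Measures concentrated on the values of a correspondence -/

theorem ContinuousCorrespondence.comp {E P A : Type*} [TopologicalSpace E] [TopologicalSpace P]
    [TopologicalSpace A] {act : E → Set A} (h : ContinuousCorrespondence act) {f : P → E}
    (hf : Continuous f) : ContinuousCorrespondence fun p => act (f p) :=
  ⟨fun C hC => (h.1 C hC).preimage hf, fun D hD => (h.2 D hD).preimage hf⟩

theorem ContinuousCorrespondence.isCompact_biUnion {E A : Type*} [TopologicalSpace E]
    [TopologicalSpace A] {act : E → Set A} (h : ContinuousCorrespondence act)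
    (hc : ∀ x, IsCompact (act x)) {K : Set E} (hK : IsCompact K) :
    IsCompact (⋃ x ∈ K, act x) := by
  refine isCompact_of_finite_subcover fun {ι} U hU hcov => ?_
  suffices ∃ t : Finset ι, ∀ x ∈ K, act x ⊆ ⋃ i ∈ t, U i by
    obtain ⟨t, ht⟩ := this
    exact ⟨t, iUnion₂_subset ht⟩
  refine hK.induction_on (p := fun s => ∃ t : Finset ι, ∀ x ∈ s, act x ⊆ ⋃ i ∈ t, U i)
    ⟨∅, by simp⟩ ?_ ?_ ?_
  · rintro s s' hss ⟨t, ht⟩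
    exact ⟨t, fun x hx => ht x (hss hx)⟩
  · classical
    rintro s s' ⟨t, ht⟩ ⟨t', ht'⟩
    refine ⟨t ∪ t', fun x hx => ?_⟩
    rw [Finset.set_biUnion_union]
    rcases hx with hx | hx
    · exact (ht x hx).trans subset_union_left
    · exact (ht' x hx).trans subset_union_right
  · intro x hx
    obtain ⟨t, ht⟩ := (hc x).elim_finite_subcover U hU ((subset_biUnion_of_mem hx).trans hcov)
    refine ⟨{x' | (act x' ∩ (⋃ i ∈ t, U i)ᶜ).Nonempty}ᶜ, ?_, t, fun x' hx' => ?_⟩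
    · refine mem_nhdsWithin_of_mem_nhds (IsOpen.mem_nhds ?_ ?_)
      · exact (h.1 _ (isOpen_biUnion fun i _ => hU i).isClosed_compl).isOpen_compl
      · rintro ⟨a, ha, ha'⟩
        exact ha' (ht ha)
    · intro a ha
      by_contra hcon
      exact hx' ⟨a, ha, hcon⟩

/-- Sequential form of upper hemicontinuity with compact values: selections along a convergent
sequence of parameters subconverge to a point of the value at the limit. -/
def SeqUpperHemicontinuous {P Y : Type*} [TopologicalSpace P] [TopologicalSpace Y]
    (S : P → Set Y) : Prop :=
  ∀ (p : ℕ → P) (p₀ : P), Tendsto p atTop (𝓝 p₀) → ∀ y : ℕ → Y, (∀ n, y n ∈ S (p n)) →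
    ∃ y₀ ∈ S p₀, ∃ φ : ℕ → ℕ, StrictMono φ ∧ Tendsto (y ∘ φ) atTop (𝓝 y₀)

section

variable {A : Type*} [TopologicalSpace A] [TopologicalSpace.MetrizableSpace A]
  [SecondCountableTopology A] [MeasurableSpace A] [BorelSpace A]

theorem diracProba_mem_probOn {s : Set A} {a : A} (ha : a ∈ s) : diracProba a ∈ probOn s := by
  change Measure.dirac a sᶜ = 0
  simp [ha]

theorem probOn_nonempty {s : Set A} (hs : s.Nonempty) : (probOn s).Nonempty :=
  ⟨_, diracProba_mem_probOn hs.some_mem⟩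

theorem isCompact_probOn {s : Set A} (hs : IsCompact s) : IsCompact (probOn s) := by
  have h := isCompact_setOfPred_probabilityMeasure_mass_eq_compl_isCompact_le (E := A)
    (u := fun _ => 0) (K := fun _ => s) tendsto_const_nhds (fun _ => hs) (Or.inr monotone_const)
  convert h using 1
  ext μ
  simp [probOn]

/-- The correspondence `x ↦ ℙ(act x)` inherits upper hemicontinuity: along a convergent sequence of
states the measures live on one compact set, and the portmanteau theorem confines their limits to
`act x`. -/
theorem ContinuousCorrespondence.seqUpperHemicontinuous_probOn {P : Type*} [TopologicalSpace P]
    {act : P → Set A} (h : ContinuousCorrespondence act) (hc : ∀ x, IsCompact (act x)) :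
    SeqUpperHemicontinuous fun x => probOn (act x) := by
  intro p p₀ hp μ hμ
  have hK := isCompact_probOn (h.isCompact_biUnion hc hp.isCompact_insert_range)
  have hmem : ∀ n, μ n ∈ probOn (⋃ x ∈ insert p₀ (range p), act x) := fun n => by
    refine measure_mono_null (compl_subset_compl.2 ?_) (hμ n)
    exact subset_biUnion_of_mem (u := act) (mem_insert_of_mem _ (mem_range_self n))
  obtain ⟨μ₀, -, φ, hφ, hlim⟩ := hK.tendsto_subseq hmem
  refine ⟨μ₀, ?_, φ, hφ, hlim⟩
  refine measure_null_of_locally_null _ fun a ha => ?_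
  obtain ⟨D, hD, haD, hdisj⟩ : ∃ D, IsOpen D ∧ a ∈ D ∧ Disjoint (closure D) (act p₀) := by
    obtain ⟨D, hD, hcl⟩ := exists_mem_nhds_isClosed_subset
      ((hc p₀).isClosed.isOpen_compl.mem_nhds ha)
    refine ⟨interior D, isOpen_interior, mem_interior_iff_mem_nhds.2 hD, ?_⟩
    refine disjoint_left.2 fun z hz => hcl.2 (closure_minimal interior_subset hcl.1 hz)
  refine ⟨D, mem_nhdsWithin_of_mem_nhds (hD.mem_nhds haD), ?_⟩
  have hev : ∀ᶠ n in atTop, (μ (φ n) : Measure A) D = 0 := by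
    have h1 : {x | (act x ∩ closure D).Nonempty}ᶜ ∈ 𝓝 p₀ := by
      refine (h.1 _ isClosed_closure).isOpen_compl.mem_nhds ?_
      rintro ⟨z, hz, hz'⟩
      exact disjoint_left.1 hdisj hz' hz
    filter_upwards [hφ.tendsto_atTop.eventually (hp.eventually h1)] with n hn
    refine measure_mono_null ?_ (hμ (φ n))
    intro z hz hz'
    exact hn ⟨z, hz', subset_closure hz⟩
  have hle := ProbabilityMeasure.le_liminf_measure_open_of_tendsto hlim hD
  rw [liminf_congr (u := fun i => ((μ ∘ φ) i : Measure A) D) (v := fun _ => 0) hev,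
    liminf_const] at hle
  exact le_antisymm hle zero_le

end

/-- The parameters at which some `y ∈ SY p ∩ C` keeps `U p a y ≤ w p` for all `a ∈ SA p` form a
closed set. Lower hemicontinuity of `SA` suffices for the universally quantified variable. -/
theorem isClosed_setOf_exists_forall_le {P A Y : Type*} [TopologicalSpace P] [SequentialSpace P]
    [TopologicalSpace A] [TopologicalSpace Y] {SA : P → Set A} {SY : P → Set Y}
    (hA : ContinuousCorrespondence SA) (hY : SeqUpperHemicontinuous SY)
    {U : P × A × Y → ℝ} (hU : Continuous U) {w : P → ℝ} (hw : Continuous w)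
    {C : Set Y} (hC : IsClosed C) :
    IsClosed {p | ∃ y ∈ SY p, y ∈ C ∧ ∀ a ∈ SA p, U (p, a, y) ≤ w p} := by
  refine IsSeqClosed.isClosed fun p p₀ hp hlim => ?_
  choose y hy hyC hle using hp
  obtain ⟨y₀, hy₀, φ, hφ, hylim⟩ := hY p p₀ hlim y hy
  refine ⟨y₀, hy₀, hC.mem_of_tendsto hylim (Eventually.of_forall fun n => hyC _), fun a ha => ?_⟩
  by_contra hlt
  have hopen : IsOpen {q : P × A × Y | w q.1 < U q} := isOpen_lt (hw.comp continuous_fst) hU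
  have hmem := hopen.mem_nhds (show (p₀, a, y₀) ∈ {q : P × A × Y | w q.1 < U q} from not_le.1 hlt)
  rw [nhds_prod_eq, nhds_prod_eq, mem_prod_iff] at hmem
  obtain ⟨V, hV, W, hW, hVW⟩ := hmem
  rw [mem_prod_iff] at hW
  obtain ⟨D, hD, N, hN, hDN⟩ := hW
  have hA' : {x | (SA x ∩ interior D).Nonempty} ∈ 𝓝 p₀ :=
    (hA.2 _ isOpen_interior).mem_nhds ⟨a, ha, mem_interior_iff_mem_nhds.2 hD⟩
  have hsub : Tendsto (p ∘ φ) atTop (𝓝 p₀) := hlim.comp hφ.tendsto_atTop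
  obtain ⟨n, hn1, ⟨a', ha', haD⟩, hn3⟩ :=
    ((hsub.eventually hV).and ((hsub.eventually hA').and (hylim.eventually hN))).exists
  have : (p (φ n), a', y (φ n)) ∈ {q : P × A × Y | w q.1 < U q} :=
    hVW ⟨hn1, hDN ⟨interior_subset haD, hn3⟩⟩
  exact absurd (hle (φ n) a' ha') (not_le.2 this)

/-! ### Minimax theorem for mixed strategies -/

section

variable {A B : Type*} [TopologicalSpace A] [TopologicalSpace.MetrizableSpace A]
  [SecondCountableTopology A] [MeasurableSpace A] [BorelSpace A]
  [TopologicalSpace B] [TopologicalSpace.MetrizableSpace B]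
  [SecondCountableTopology B] [MeasurableSpace B] [BorelSpace B]

/-- A probability measure, seen as the family of its integrals of bounded continuous functions. -/
noncomputable def integralFamily (μ : ProbabilityMeasure A) :
    BoundedContinuousFunction A ℝ → ℝ := fun f => ∫ a, f a ∂(μ : Measure A)

theorem continuous_integralFamily : Continuous (integralFamily (A := A)) :=
  continuous_pi fun f => ProbabilityMeasure.continuous_integral_boundedContinuousFunction f

theorem convex_integralFamily_image_probOn (s : Set A) :
    Convex ℝ (integralFamily '' probOn s) := by
  rintro _ ⟨μ, hμ, rfl⟩ _ ⟨ν, hν, rfl⟩ a b ha hb hab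
  have hp : IsProbabilityMeasure
      (ENNReal.ofReal a • (μ : Measure A) + ENNReal.ofReal b • (ν : Measure A)) := by
    constructor
    simp [← ENNReal.ofReal_add ha hb, hab]
  refine ⟨⟨_, hp⟩, ?_, ?_⟩
  · have h1 : (μ : Measure A) sᶜ = 0 := hμ
    have h2 : (ν : Measure A) sᶜ = 0 := hν
    change (ENNReal.ofReal a • (μ : Measure A) + ENNReal.ofReal b • (ν : Measure A)) sᶜ = 0
    simp [h1, h2]
  · funext f
    have h1 : Integrable f (μ : Measure A) := f.integrable _
    have h2 : Integrable f (ν : Measure A) := f.integrable _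
    simp only [integralFamily, Pi.add_apply, Pi.smul_apply, smul_eq_mul,
      ProbabilityMeasure.coe_mk]
    rw [integral_add_measure (h1.smul_measure ENNReal.ofReal_ne_top)
      (h2.smul_measure ENNReal.ofReal_ne_top), integral_smul_measure, integral_smul_measure,
      ENNReal.toReal_ofReal ha, ENNReal.toReal_ofReal hb, smul_eq_mul, smul_eq_mul]

/-- The partial integral `a ↦ ∫ u(a,b) ν(db)` of a bounded continuous function. -/
noncomputable def averageRight (u : BoundedContinuousFunction (A × B) ℝ)
    (ν : ProbabilityMeasure B) : BoundedContinuousFunction A ℝ :=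
  BoundedContinuousFunction.ofNormedAddCommGroup (fun a => ∫ b, u (a, b) ∂(ν : Measure B))
    (continuous_of_dominated (bound := fun _ => ‖u‖)
      (fun a => (by fun_prop : Continuous fun b => u (a, b)).aestronglyMeasurable)
      (fun a => Eventually.of_forall fun b => u.norm_coe_le_norm _) (integrable_const _)
      (Eventually.of_forall fun b => by fun_prop))
    ‖u‖ (fun a => by
      refine (norm_integral_le_of_norm_le_const (C := ‖u‖)
        (Eventually.of_forall fun b => u.norm_coe_le_norm _)).trans ?_
      simp)

/-- The partial integral `b ↦ ∫ u(a,b) μ(da)` of a bounded continuous function. -/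
noncomputable def averageLeft (u : BoundedContinuousFunction (A × B) ℝ)
    (μ : ProbabilityMeasure A) : BoundedContinuousFunction B ℝ :=
  averageRight (u.compContinuous ⟨Prod.swap, continuous_swap⟩) μ

theorem integral_averageRight (u : BoundedContinuousFunction (A × B) ℝ)
    (μ : ProbabilityMeasure A) (ν : ProbabilityMeasure B) :
    ∫ a, averageRight u ν a ∂(μ : Measure A) = ∫ c, u c ∂(μ : Measure A).prod ν :=
  (integral_prod _ (u.integrable _)).symm

theorem integral_averageLeft (u : BoundedContinuousFunction (A × B) ℝ)
    (μ : ProbabilityMeasure A) (ν : ProbabilityMeasure B) :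
    ∫ b, averageLeft u μ b ∂(ν : Measure B) = ∫ c, u c ∂(μ : Measure A).prod ν :=
  (integral_prod_symm _ (u.integrable _)).symm

/-- Mixed extensions of games with bounded continuous payoff and compact action sets have a saddle
point. Sion's theorem applies to the families of integrals, where the payoff is linear in each
variable because partial integrals of `u` are bounded continuous functions. -/
theorem exists_isSaddle_probOn (u : BoundedContinuousFunction (A × B) ℝ) {s : Set A} {t : Set B}
    (hs : IsCompact s) (ht : IsCompact t) (hsn : s.Nonempty) (htn : t.Nonempty) :
    ∃ μ ν, IsSaddle (probOn s) (probOn t)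
      (fun μ ν => ∫ c, u c ∂(μ : Measure A).prod (ν : Measure B)) μ ν := by
  let X := integralFamily '' probOn t
  let Y := integralFamily '' probOn s
  have : Nonempty (ProbabilityMeasure A) := ⟨(probOn_nonempty hsn).some⟩
  have : Nonempty (ProbabilityMeasure B) := ⟨(probOn_nonempty htn).some⟩
  let invA := Function.invFunOn (integralFamily (A := A)) (probOn s)
  let invB := Function.invFunOn (integralFamily (A := B)) (probOn t)
  have hA : ∀ y ∈ Y, invA y ∈ probOn s ∧ integralFamily (invA y) = y := fun y hy =>
    ⟨Function.invFunOn_mem hy, Function.invFunOn_eq hy⟩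
  have hB : ∀ x ∈ X, invB x ∈ probOn t ∧ integralFamily (invB x) = x := fun x hx =>
    ⟨Function.invFunOn_mem hx, Function.invFunOn_eq hx⟩
  let f : (BoundedContinuousFunction B ℝ → ℝ) → (BoundedContinuousFunction A ℝ → ℝ) → ℝ :=
    fun x y => x (averageLeft u (invA y))
  have hswap : ∀ μ ν, integralFamily ν (averageLeft u μ) = integralFamily μ (averageRight u ν) :=
    fun μ ν => (integral_averageLeft u μ ν).trans (integral_averageRight u μ ν).symm
  have hf : ∀ x ∈ X, ∀ y ∈ Y, f x y = y (averageRight u (invB x)) := by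
    intro x hx y hy
    change x (averageLeft u (invA y)) = _
    conv_lhs => rw [← (hB x hx).2]
    conv_rhs => rw [← (hA y hy).2]
    exact hswap _ _
  obtain ⟨x, hx, y, hy, hxy⟩ := Sion.exists_isSaddlePointOn (X := X) (Y := Y) (f := f)
    ((probOn_nonempty htn).image _) (convex_integralFamily_image_probOn t)
    ((isCompact_probOn ht).image continuous_integralFamily)
    (fun y _ => (continuous_apply _).lowerSemicontinuous.lowerSemicontinuousOn _)
    (fun y _ => ((LinearMap.proj (R := ℝ) (φ := fun _ : BoundedContinuousFunction B ℝ => ℝ)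
      (averageLeft u (invA y))).convexOn (convex_integralFamily_image_probOn t)).quasiconvexOn)
    (convex_integralFamily_image_probOn s) ((probOn_nonempty hsn).image _)
    ((isCompact_probOn hs).image continuous_integralFamily)
    (fun x hx => ((continuous_apply (averageRight u (invB x))).continuousOn.congr
      fun y hy => hf x hx y hy).upperSemicontinuousOn)
    (fun x hx => (((LinearMap.proj (R := ℝ) (φ := fun _ : BoundedContinuousFunction A ℝ => ℝ)
      (averageRight u (invB x))).concaveOn (convex_integralFamily_image_probOn s)).congr
        fun y hy => (hf x hx y hy).symm).quasiconcaveOn)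
  have key : ∀ x ∈ X, ∀ y ∈ Y, ∀ μ ν, integralFamily ν = x → integralFamily μ = y →
      ∫ c, u c ∂(μ : Measure A).prod (ν : Measure B) = f x y := by
    rintro x hx y hy μ ν rfl rfl
    rw [← integral_averageLeft]
    change integralFamily ν (averageLeft u μ) = integralFamily ν (averageLeft u (invA _))
    rw [hswap, hswap, (hA _ hy).2]
  refine ⟨invA y, invB x, (hA y hy).1, (hB x hx).1, fun μ hμ => ?_, fun ν hν => ?_⟩
  · have h1 := hxy x hx _ (mem_image_of_mem _ hμ)
    rw [← key x hx _ (mem_image_of_mem _ hμ) μ (invB x) (hB x hx).2 rfl,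
      ← key x hx y hy (invA y) (invB x) (hB x hx).2 (hA y hy).2] at h1
    exact h1
  · have h1 := hxy _ (mem_image_of_mem _ hν) y hy
    rw [← key _ (mem_image_of_mem _ hν) y hy (invA y) ν rfl (hA y hy).2,
      ← key x hx y hy (invA y) (invB x) (hB x hx).2 (hA y hy).2] at h1
    exact h1

end

/-! ### Parametric families of mixed games -/

/-- The value of a bounded game with a saddle point, the actions of the players being
parametrized by arbitrary index types. -/
theorem IsSaddle.iInf_iSup_eq {M N ι κ : Type*} {S : Set M} {T : Set N} {φ : M → N → ℝ} {c : M}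
    {d : N} (h : IsSaddle S T φ c d) {F : ι → M} {G : κ → N} (hF : range F = S)
    (hG : range G = T) {K : ℝ} (hK : ∀ m n, |φ m n| ≤ K) :
    ⨅ k, ⨆ i, φ (F i) (G k) = φ c d := by
  subst hF hG
  obtain ⟨⟨i₀, rfl⟩, ⟨k₀, rfl⟩, h1, h2⟩ := h
  have : Nonempty ι := ⟨i₀⟩
  have : Nonempty κ := ⟨k₀⟩
  have hbdd : ∀ k, BddAbove (range fun i => φ (F i) (G k)) := fun k =>
    ⟨K, by rintro _ ⟨i, rfl⟩; exact (abs_le.1 (hK _ _)).2⟩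
  refine le_antisymm ?_ ?_
  · refine (ciInf_le ⟨-K, ?_⟩ k₀).trans (ciSup_le fun i => h1 _ (mem_range_self i))
    rintro _ ⟨k, rfl⟩
    exact (abs_le.1 (hK _ _)).1.trans (le_ciSup (hbdd k) i₀)
  · exact le_ciInf fun k => (h2 _ (mem_range_self k)).trans (le_ciSup (hbdd k) i₀)

theorem IsSaddle.iSup_iInf_eq {M N ι κ : Type*} {S : Set M} {T : Set N} {φ : M → N → ℝ} {c : M}
    {d : N} (h : IsSaddle S T φ c d) {F : ι → M} {G : κ → N} (hF : range F = S)
    (hG : range G = T) {K : ℝ} (hK : ∀ m n, |φ m n| ≤ K) :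
    ⨆ i, ⨅ k, φ (F i) (G k) = φ c d := by
  subst hF hG
  obtain ⟨⟨i₀, rfl⟩, ⟨k₀, rfl⟩, h1, h2⟩ := h
  have : Nonempty ι := ⟨i₀⟩
  have : Nonempty κ := ⟨k₀⟩
  have hbdd : ∀ i, BddBelow (range fun k => φ (F i) (G k)) := fun i =>
    ⟨-K, by rintro _ ⟨k, rfl⟩; exact (abs_le.1 (hK _ _)).1⟩
  refine le_antisymm ?_ ?_
  · exact ciSup_le fun i => (ciInf_le (hbdd i) k₀).trans (h1 _ (mem_range_self i))
  · refine (le_ciInf fun k => h2 _ (mem_range_self k)).trans (le_ciSup (f := fun i =>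
      ⨅ k, φ (F i) (G k)) ⟨K, ?_⟩ i₀)
    rintro _ ⟨i, rfl⟩
    exact (ciInf_le (hbdd i) k₀).trans (abs_le.1 (hK _ _)).2

/-- Continuous correspondences with nonempty compact values. -/
structure IsActionCorrespondence {P A : Type*} [TopologicalSpace P] [TopologicalSpace A]
    (S : P → Set A) : Prop where
  continuous : ContinuousCorrespondence S
  isCompact : ∀ p, IsCompact (S p)
  nonempty : ∀ p, (S p).Nonempty

section

variable {P A B : Type*}
  [TopologicalSpace P] [TopologicalSpace.MetrizableSpace P]
  [SecondCountableTopology P] [MeasurableSpace P] [BorelSpace P]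
  [TopologicalSpace A] [TopologicalSpace.MetrizableSpace A]
  [SecondCountableTopology A] [MeasurableSpace A] [BorelSpace A]
  [TopologicalSpace B] [TopologicalSpace.MetrizableSpace B]
  [SecondCountableTopology B] [MeasurableSpace B] [BorelSpace B]

theorem IsActionCorrespondence.exists_measurable_selection {S : P → Set A}
    (hS : IsActionCorrespondence S) {R : P → Set (ProbabilityMeasure A)}
    (hne : ∀ p, (probOn (S p) ∩ R p).Nonempty) (hR : ∀ p, IsClosed (R p))
    (hcl : ∀ C, IsClosed C → IsClosed {p | (probOn (S p) ∩ R p ∩ C).Nonempty}) :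
    ∃ s : P → ProbabilityMeasure A, Measurable s ∧ ∀ p, s p ∈ probOn (S p) ∩ R p := by
  obtain ⟨h, hcont, hsep⟩ := exists_seq_continuous_separating A
  obtain ⟨s, hs, hsm⟩ := _root_.exists_measurable_selection (fun p => probOn (S p) ∩ R p) hne
    (fun p => (isCompact_probOn (hS.isCompact p)).inter_right (hR p))
    (fun C hC => (hcl C hC).measurableSet) h hcont hsep
  exact ⟨s, measurable_probabilityMeasure_of_isClosed s hsm, hs⟩

/-- The expected payoff `∫∫ u(p,a,b) μ(da) ν(db)`. -/
noncomputable def mixedPayoff (u : BoundedContinuousFunction (P × A × B) ℝ) (p : P)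
    (μ : ProbabilityMeasure A) (ν : ProbabilityMeasure B) : ℝ :=
  ∫ c, u (p, c) ∂(μ : Measure A).prod (ν : Measure B)

/-- The upper value of the mixed game with parameter `p`. -/
noncomputable def mixedValue (u : BoundedContinuousFunction (P × A × B) ℝ) (SA : P → Set A)
    (SB : P → Set B) (p : P) : ℝ :=
  ⨅ ν : probOn (SB p), ⨆ μ : probOn (SA p), mixedPayoff u p μ ν

variable (u : BoundedContinuousFunction (P × A × B) ℝ)

theorem abs_mixedPayoff_le (p : P) (μ : ProbabilityMeasure A) (ν : ProbabilityMeasure B) :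
    |mixedPayoff u p μ ν| ≤ ‖u‖ := by
  refine (norm_integral_le_of_norm_le_const (C := ‖u‖)
    (Eventually.of_forall fun b => u.norm_coe_le_norm _)).trans ?_
  simp

theorem continuous_mixedPayoff :
    Continuous fun q : P × ProbabilityMeasure A × ProbabilityMeasure B =>
      mixedPayoff u q.1 q.2.1 q.2.2 := by
  have h : Continuous fun q : P × ProbabilityMeasure A × ProbabilityMeasure B =>
      (diracProba q.1).prod (q.2.1.prod q.2.2) :=
    ProbabilityMeasure.continuous_prod.comp ((continuous_diracProba.comp continuous_fst).prodMk
      (ProbabilityMeasure.continuous_prod.comp continuous_snd))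
  refine ((ProbabilityMeasure.continuous_integral_boundedContinuousFunction u).comp h).congr ?_
  rintro ⟨p, μ, ν⟩
  change ∫ z, u z ∂(Measure.dirac p).prod ((μ : Measure A).prod (ν : Measure B)) = _
  rw [integral_prod _ (u.integrable _), integral_dirac]
  rfl

theorem integrable_section (p : P) (m : Measure (A × B)) [IsFiniteMeasure m] :
    Integrable (fun c => u (p, c)) m :=
  (u.compContinuous ⟨fun c => (p, c), by fun_prop⟩).integrable m

theorem mixedPayoff_eq_integral_left (p : P) (μ : ProbabilityMeasure A)
    (ν : ProbabilityMeasure B) :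
    mixedPayoff u p μ ν = ∫ a, mixedPayoff u p (diracProba a) ν ∂(μ : Measure A) := by
  rw [mixedPayoff, integral_prod _ (integrable_section u p _)]
  refine integral_congr_ae (Eventually.of_forall fun a => ?_)
  change _ = ∫ c, u (p, c) ∂(Measure.dirac a).prod (ν : Measure B)
  rw [integral_prod _ (integrable_section u p _), integral_dirac]

theorem mixedPayoff_eq_integral_right (p : P) (μ : ProbabilityMeasure A)
    (ν : ProbabilityMeasure B) :
    mixedPayoff u p μ ν = ∫ b, mixedPayoff u p μ (diracProba b) ∂(ν : Measure B) := by
  rw [mixedPayoff, integral_prod_symm _ (integrable_section u p _)]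
  refine integral_congr_ae (Eventually.of_forall fun b => ?_)
  change _ = ∫ c, u (p, c) ∂(μ : Measure A).prod (Measure.dirac b)
  rw [integral_prod_symm _ (integrable_section u p _), integral_dirac]

variable {u}

theorem mixedPayoff_le_of_forall_left {p : P} {s : Set A} {μ : ProbabilityMeasure A}
    (hμ : μ ∈ probOn s) {ν : ProbabilityMeasure B} {c : ℝ}
    (h : ∀ a ∈ s, mixedPayoff u p (diracProba a) ν ≤ c) : mixedPayoff u p μ ν ≤ c := by
  rw [mixedPayoff_eq_integral_left]
  have hae : ∀ᵐ a ∂(μ : Measure A), a ∈ s := hμ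
  have hc : Continuous fun a => mixedPayoff u p (diracProba a) ν :=
    (continuous_mixedPayoff u).comp
      (continuous_const.prodMk (continuous_diracProba.prodMk continuous_const))
  refine (integral_mono_ae (Integrable.of_bound hc.aestronglyMeasurable ‖u‖
    (Eventually.of_forall fun a => abs_mixedPayoff_le u _ _ _)) (integrable_const c)
    (hae.mono h)).trans ?_
  simp

theorem le_mixedPayoff_of_forall_right {p : P} {t : Set B} {μ : ProbabilityMeasure A}
    {ν : ProbabilityMeasure B} (hν : ν ∈ probOn t) {c : ℝ}
    (h : ∀ b ∈ t, c ≤ mixedPayoff u p μ (diracProba b)) : c ≤ mixedPayoff u p μ ν := by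
  rw [mixedPayoff_eq_integral_right]
  have hae : ∀ᵐ b ∂(ν : Measure B), b ∈ t := hν
  have hc : Continuous fun b => mixedPayoff u p μ (diracProba b) :=
    (continuous_mixedPayoff u).comp
      (continuous_const.prodMk (continuous_const.prodMk continuous_diracProba))
  refine le_trans ?_ (integral_mono_ae (integrable_const c)
    (Integrable.of_bound hc.aestronglyMeasurable ‖u‖
    (Eventually.of_forall fun a => abs_mixedPayoff_le u _ _ _)) (hae.mono h))
  simp

variable {SA : P → Set A} {SB : P → Set B}

theorem mixedValue_eq_of_isSaddle {p : P} {μ : ProbabilityMeasure A} {ν : ProbabilityMeasure B}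
    (h : IsSaddle (probOn (SA p)) (probOn (SB p)) (mixedPayoff u p) μ ν) :
    mixedValue u SA SB p = mixedPayoff u p μ ν :=
  h.iInf_iSup_eq Subtype.range_coe Subtype.range_coe (abs_mixedPayoff_le u p)

variable (hA : IsActionCorrespondence SA) (hB : IsActionCorrespondence SB)
include hA hB

theorem exists_isSaddle_mixedPayoff (u : BoundedContinuousFunction (P × A × B) ℝ) (p : P) :
    ∃ μ ν, IsSaddle (probOn (SA p)) (probOn (SB p)) (mixedPayoff u p) μ ν :=
  exists_isSaddle_probOn (u.compContinuous ⟨fun c => (p, c), by fun_prop⟩) (hA.isCompact p)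
    (hB.isCompact p) (hA.nonempty p) (hB.nonempty p)

theorem mixedValue_le_iff {p : P} {c : ℝ} :
    mixedValue u SA SB p ≤ c ↔
      ∃ ν ∈ probOn (SB p), ∀ a ∈ SA p, mixedPayoff u p (diracProba a) ν ≤ c := by
  obtain ⟨μ, ν, h⟩ := exists_isSaddle_mixedPayoff hA hB u p
  rw [mixedValue_eq_of_isSaddle h]
  constructor
  · exact fun hc => ⟨ν, h.2.1, fun a ha => (h.2.2.1 _ (diracProba_mem_probOn ha)).trans hc⟩
  · rintro ⟨ν', hν', hle⟩
    exact (h.2.2.2 ν' hν').trans (mixedPayoff_le_of_forall_left h.1 hle)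

theorem le_mixedValue_iff {p : P} {c : ℝ} :
    c ≤ mixedValue u SA SB p ↔
      ∃ μ ∈ probOn (SA p), ∀ b ∈ SB p, c ≤ mixedPayoff u p μ (diracProba b) := by
  obtain ⟨μ, ν, h⟩ := exists_isSaddle_mixedPayoff hA hB u p
  rw [mixedValue_eq_of_isSaddle h]
  constructor
  · exact fun hc => ⟨μ, h.1, fun b hb => hc.trans (h.2.2.2 _ (diracProba_mem_probOn hb))⟩
  · rintro ⟨μ', hμ', hle⟩
    exact (le_mixedPayoff_of_forall_right h.2.1 hle).trans (h.2.2.1 μ' hμ')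

theorem isClosed_setOf_exists_mixedPayoff_le {w : P → ℝ} (hw : Continuous w)
    {C : Set (ProbabilityMeasure B)} (hC : IsClosed C) :
    IsClosed {p | ∃ ν ∈ probOn (SB p), ν ∈ C ∧
      ∀ a ∈ SA p, mixedPayoff u p (diracProba a) ν ≤ w p} :=
  isClosed_setOf_exists_forall_le hA.continuous
    (hB.continuous.seqUpperHemicontinuous_probOn hB.isCompact)
    (U := fun q => mixedPayoff u q.1 (diracProba q.2.1) q.2.2)
    ((continuous_mixedPayoff u).comp (continuous_fst.prodMk
      ((continuous_diracProba.comp continuous_snd.fst).prodMk continuous_snd.snd))) hw hC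

theorem isClosed_setOf_exists_le_mixedPayoff {w : P → ℝ} (hw : Continuous w)
    {C : Set (ProbabilityMeasure A)} (hC : IsClosed C) :
    IsClosed {p | ∃ μ ∈ probOn (SA p), μ ∈ C ∧
      ∀ b ∈ SB p, w p ≤ mixedPayoff u p μ (diracProba b)} := by
  have h := isClosed_setOf_exists_forall_le hB.continuous
    (hA.continuous.seqUpperHemicontinuous_probOn hA.isCompact)
    (U := fun q => -mixedPayoff u q.1 q.2.2 (diracProba q.2.1))
    ((continuous_mixedPayoff u).comp (continuous_fst.prodMk
      (continuous_snd.snd.prodMk (continuous_diracProba.comp continuous_snd.fst)))).neg hw.neg hC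
  simpa only [Pi.neg_apply, neg_le_neg_iff] using h

/-- Maximum theorem for mixed games. By the saddle point property, one of the two players may be
restricted to pure actions, so that each semicontinuity only uses lower hemicontinuity of the pure
action sets and compactness of the mixed ones. -/
theorem continuous_mixedValue (u : BoundedContinuousFunction (P × A × B) ℝ) :
    Continuous (mixedValue u SA SB) := by
  rw [continuous_iff_lower_upperSemicontinuous]
  constructor
  · rw [lowerSemicontinuous_iff_isClosed_preimage]
    intro c
    change IsClosed {p | mixedValue u SA SB p ≤ c}
    have h := isClosed_setOf_exists_mixedPayoff_le (u := u) hA hB (w := fun _ => c)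
      continuous_const isClosed_univ
    simpa only [mem_univ, true_and, ← mixedValue_le_iff hA hB] using h
  · rw [upperSemicontinuous_iff_isClosed_preimage]
    intro c
    change IsClosed {p | c ≤ mixedValue u SA SB p}
    have h := isClosed_setOf_exists_le_mixedPayoff (u := u) hA hB (w := fun _ => c)
      continuous_const isClosed_univ
    simpa only [mem_univ, true_and, ← le_mixedValue_iff hA hB] using h

theorem exists_measurable_isSaddle (u : BoundedContinuousFunction (P × A × B) ℝ) :
    ∃ (μ : P → ProbabilityMeasure A) (ν : P → ProbabilityMeasure B), Measurable μ ∧ Measurable ν ∧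
      ∀ p, IsSaddle (probOn (SA p)) (probOn (SB p)) (mixedPayoff u p) (μ p) (ν p) := by
  have hw := continuous_mixedValue hA hB u
  obtain ⟨μ, hμm, hμ⟩ := hA.exists_measurable_selection
    (R := fun p => {μ | ∀ b ∈ SB p, mixedValue u SA SB p ≤ mixedPayoff u p μ (diracProba b)})
    (fun p => (le_mixedValue_iff hA hB).1 le_rfl)
    (fun p => by
      simp only [ofPred_forall]
      refine isClosed_biInter fun b _ => isClosed_le continuous_const ?_
      exact (continuous_mixedPayoff u).comp
        (continuous_const.prodMk (continuous_id.prodMk continuous_const)))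
    (fun C hC => by
      convert isClosed_setOf_exists_le_mixedPayoff (u := u) hA hB hw hC using 1
      ext p
      constructor
      · rintro ⟨μ, ⟨h1, h2⟩, h3⟩
        exact ⟨μ, h1, h3, h2⟩
      · rintro ⟨μ, h1, h3, h2⟩
        exact ⟨μ, ⟨h1, h2⟩, h3⟩)
  obtain ⟨ν, hνm, hν⟩ := hB.exists_measurable_selection
    (R := fun p => {ν | ∀ a ∈ SA p, mixedPayoff u p (diracProba a) ν ≤ mixedValue u SA SB p})
    (fun p => (mixedValue_le_iff hA hB).1 le_rfl)
    (fun p => by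
      simp only [ofPred_forall]
      refine isClosed_biInter fun b _ => isClosed_le ?_ continuous_const
      exact (continuous_mixedPayoff u).comp
        (continuous_const.prodMk (continuous_const.prodMk continuous_id)))
    (fun C hC => by
      convert isClosed_setOf_exists_mixedPayoff_le (u := u) hA hB hw hC using 1
      ext p
      constructor
      · rintro ⟨μ, ⟨h1, h2⟩, h3⟩
        exact ⟨μ, h1, h3, h2⟩
      · rintro ⟨μ, h1, h3, h2⟩
        exact ⟨μ, ⟨h1, h2⟩, h3⟩)
  refine ⟨μ, ν, hμm, hνm, fun p => ⟨(hμ p).1, (hν p).1, fun μ' hμ' => ?_, fun ν' hν' => ?_⟩⟩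
  · exact (mixedPayoff_le_of_forall_left hμ' (hν p).2).trans
      (le_mixedPayoff_of_forall_right (hν p).1 (hμ p).2)
  · exact (mixedPayoff_le_of_forall_left (hμ p).1 (hν p).2).trans
      (le_mixedPayoff_of_forall_right hν' (hμ p).2)

theorem mixedValue_le_mul {u u' : BoundedContinuousFunction (P × A × B) ℝ} {p : P} {k : ℝ}
    (hk : 0 ≤ k) (h : ∀ c, u (p, c) ≤ k * u' (p, c)) :
    mixedValue u SA SB p ≤ k * mixedValue u' SA SB p := by
  obtain ⟨μ, ν, hs⟩ := exists_isSaddle_mixedPayoff hA hB u p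
  obtain ⟨μ', ν', hs'⟩ := exists_isSaddle_mixedPayoff hA hB u' p
  rw [mixedValue_eq_of_isSaddle hs, mixedValue_eq_of_isSaddle hs']
  refine (hs.2.2.2 ν' hs'.2.1).trans (le_trans ?_
    (mul_le_mul_of_nonneg_left (hs'.2.2.1 μ hs.1) hk))
  rw [mixedPayoff, mixedPayoff, ← integral_const_mul]
  exact integral_mono (integrable_section u p _) ((integrable_section u' p _).const_mul k) h

theorem le_mixedValue {p : P} {m : ℝ} (h : ∀ c, m ≤ u (p, c)) : m ≤ mixedValue u SA SB p := by
  obtain ⟨μ, ν, hs⟩ := exists_isSaddle_mixedPayoff hA hB u p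
  rw [mixedValue_eq_of_isSaddle hs]
  refine le_trans ?_ (integral_mono (integrable_const m) (integrable_section u p _) h)
  simp

theorem mixedValue_le {p : P} {m : ℝ} (h : ∀ c, u (p, c) ≤ m) : mixedValue u SA SB p ≤ m := by
  obtain ⟨μ, ν, hs⟩ := exists_isSaddle_mixedPayoff hA hB u p
  rw [mixedValue_eq_of_isSaddle hs]
  refine (integral_mono (integrable_section u p _) (integrable_const m) h).trans ?_
  simp

end

/-! ### The one-stage game -/

/-- Decision rules take every admissible value at a given state: modify a measurable selector at that
state. Hence infima and suprema over decision rules, evaluated at one state, run over `ℙ(act x)`. -/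
theorem DecisionRule.range_apply {E A : Type*} [MeasurableSpace E] [MeasurableSingletonClass E]
    [MeasurableSpace A] {act : E → Set A} (hact : ∃ s : E → A, Measurable s ∧ ∀ x, s x ∈ act x)
    (hne : ∀ x, MeasurableSet (act x)) (x : E) :
    range (fun f : DecisionRule act => f.1 x) = probOn (act x) := by
  classical
  obtain ⟨s, hs, hsa⟩ := hact
  refine Subset.antisymm ?_ fun μ hμ => ?_
  · rintro _ ⟨f, rfl⟩
    exact f.2.2 x
  · refine ⟨⟨fun y => if y = x then μ else ⟨Measure.dirac (s y), inferInstance⟩, ?_, ?_⟩, ?_⟩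
    · refine Measurable.ite (measurableSet_singleton x) measurable_const ?_
      exact (Measure.measurable_dirac.comp hs).subtype_mk
    · intro y
      by_cases hy : y = x
      · subst hy
        simpa using hμ
      · simp only [hy]
        change Measure.dirac (s y) (act y)ᶜ = 0
        rw [Measure.dirac_apply' _ (hne y).compl]
        simp [hsa y]
    · simp

namespace RSGame

section

variable {E A B : Type*}
    [TopologicalSpace E] [TopologicalSpace.MetrizableSpace E] [SecondCountableTopology E]
    [MeasurableSpace E] [BorelSpace E]
    [TopologicalSpace A] [TopologicalSpace.MetrizableSpace A] [SecondCountableTopology A]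
    [MeasurableSpace A] [BorelSpace A]
    [TopologicalSpace B] [TopologicalSpace.MetrizableSpace B] [SecondCountableTopology B]
    [MeasurableSpace B] [BorelSpace B]
    {G : RSGame E A B}

theorem coe_discount_one (γ : Ioc (0 : ℝ) G.γbar) : (G.discount 1 γ : ℝ) = γ * G.β := by
  simp [discount]

theorem continuous_discount (G : RSGame E A B) (n : ℕ) : Continuous (G.discount n) := by
  unfold discount
  fun_prop

theorem ContinuityCompactness.isActionCorrespondence_A (hG : G.ContinuityCompactness) :
    IsActionCorrespondence fun p : E × Ioc (0 : ℝ) G.γbar => G.actA p.1 where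
  continuous := hG.continuous_actA.comp continuous_fst
  isCompact p := hG.isCompact_actA p.1
  nonempty p := G.exists_selectorA.elim fun _ h => ⟨_, h.2 p.1⟩

theorem ContinuityCompactness.isActionCorrespondence_B (hG : G.ContinuityCompactness) :
    IsActionCorrespondence fun p : E × Ioc (0 : ℝ) G.γbar => G.actB p.1 where
  continuous := hG.continuous_actB.comp continuous_fst
  isCompact p := hG.isCompact_actB p.1
  nonempty p := G.exists_selectorB.elim fun _ h => ⟨_, h.2 p.1⟩

/-- Weak continuity of `Q` upgrades to functions that also depend continuously on the risk
parameter: integrate against the product of `Q` with a Dirac measure. -/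
theorem ContinuityCompactness.continuous_integral_Q (hG : G.ContinuityCompactness)
    (v : BoundedContinuousFunction (E × Ioc (0 : ℝ) G.γbar) ℝ) :
    Continuous fun z : (E × Ioc (0 : ℝ) G.γbar) × A × B =>
      ∫ x', v (x', G.discount 1 z.1.2) ∂G.Q (z.1.1, z.2) := by
  let q : E × A × B → ProbabilityMeasure E := fun c => ⟨G.Q c, inferInstance⟩
  have hq : Continuous q :=
    ProbabilityMeasure.continuous_iff_forall_continuous_integral.2 hG.weaklyContinuous_Q
  have h : Continuous fun z : (E × Ioc (0 : ℝ) G.γbar) × A × B =>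
      (q (z.1.1, z.2)).prod (diracProba (G.discount 1 z.1.2)) :=
    ProbabilityMeasure.continuous_prod.comp ((hq.comp (by fun_prop)).prodMk
      (continuous_diracProba.comp ((G.continuous_discount 1).comp (by fun_prop))))
  refine ((ProbabilityMeasure.continuous_integral_boundedContinuousFunction v).comp h).congr ?_
  intro z
  change ∫ y, v y ∂(G.Q (z.1.1, z.2)).prod (Measure.dirac (G.discount 1 z.1.2)) = _
  rw [integral_prod _ (v.integrable _)]
  refine integral_congr_ae (Eventually.of_forall fun x => ?_)
  exact integral_dirac _ _

theorem exp_mul_r_le (G : RSGame E A B) (γ : Ioc (0 : ℝ) G.γbar) (c : E × A × B) :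
    Real.exp (γ * G.r c) ≤ Real.exp (γ * G.rbar) :=
  Real.exp_le_exp.2 (mul_le_mul_of_nonneg_left (G.r_le c) γ.2.1.le)

theorem one_le_exp_mul_r (G : RSGame E A B) (γ : Ioc (0 : ℝ) G.γbar) (c : E × A × B) :
    1 ≤ Real.exp (γ * G.r c) :=
  Real.one_le_exp (mul_nonneg γ.2.1.le (G.r_nonneg c))

/-- The payoff `exp(γ r(x,a,b)) ∫ v(x',βγ) Q(dx'|x,a,b)` of the one-stage game with terminal
reward `v`. -/
noncomputable def stagePayoff (hG : G.ContinuityCompactness)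
    (v : BoundedContinuousFunction (E × Ioc (0 : ℝ) G.γbar) ℝ) :
    BoundedContinuousFunction ((E × Ioc (0 : ℝ) G.γbar) × A × B) ℝ :=
  BoundedContinuousFunction.ofNormedAddCommGroup
    (fun z => Real.exp (z.1.2 * G.r (z.1.1, z.2)) *
      ∫ x', v (x', G.discount 1 z.1.2) ∂G.Q (z.1.1, z.2))
    ((Real.continuous_exp.comp ((by fun_prop : Continuous fun z : (E × Ioc (0 : ℝ) G.γbar) × A × B
      => (z.1.2 : ℝ)).mul (hG.continuous_r.comp (by fun_prop)))).mul (hG.continuous_integral_Q v))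
    (Real.exp (G.γbar * |G.rbar|) * ‖v‖) (fun z => by
      rw [norm_mul, Real.norm_eq_abs, Real.abs_exp]
      gcongr
      · exact G.r_nonneg _
      · exact G.γbar_pos.le
      · exact z.1.2.2.2
      · exact (G.r_le _).trans (le_abs_self _)
      · refine (norm_integral_le_of_norm_le_const (C := ‖v‖)
          (Eventually.of_forall fun b => v.norm_coe_le_norm _)).trans ?_
        simp)

theorem stagePayoff_apply (hG : G.ContinuityCompactness)
    (v : BoundedContinuousFunction (E × Ioc (0 : ℝ) G.γbar) ℝ)
    (z : (E × Ioc (0 : ℝ) G.γbar) × A × B) :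
    stagePayoff hG v z = Real.exp (z.1.2 * G.r (z.1.1, z.2)) *
      ∫ x', v (x', G.discount 1 z.1.2) ∂G.Q (z.1.1, z.2) := rfl

theorem integrable_comp_discount (m : Measure E) [IsFiniteMeasure m]
    (v : BoundedContinuousFunction (E × Ioc (0 : ℝ) G.γbar) ℝ) (γ : Ioc (0 : ℝ) G.γbar) :
    Integrable (fun x' => v (x', G.discount 1 γ)) m :=
  (v.compContinuous ⟨fun x' => (x', G.discount 1 γ), by fun_prop⟩).integrable m

theorem L_eq_mixedPayoff (hG : G.ContinuityCompactness)
    (v : BoundedContinuousFunction (E × Ioc (0 : ℝ) G.γbar) ℝ) (p : E × Ioc (0 : ℝ) G.γbar)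
    (μ : ProbabilityMeasure A) (ν : ProbabilityMeasure B) :
    G.L v p μ ν = mixedPayoff (stagePayoff hG v) p μ ν := by
  have hm : Measurable fun c : A × B => G.Qtilde p.1 p.2 c.1 c.2 := by
    refine Measure.measurable_of_measurable_coe _ fun s hs => ?_
    simp only [Qtilde, Measure.smul_apply, smul_eq_mul]
    have h1 : Measurable fun c : A × B => G.r (p.1, c) := G.measurable_r.comp measurable_prodMk_left
    have h2 : Measurable fun c : A × B => G.Q (p.1, c) s :=
      (G.Q.measurable_coe hs).comp measurable_prodMk_left
    exact ((h1.const_mul _).exp.ennreal_ofReal).mul h2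
  let K : Kernel (A × B) E := ⟨fun c => G.Qtilde p.1 p.2 c.1 c.2, hm⟩
  have hK : IsFiniteKernel K := by
    refine ⟨ENNReal.ofReal (Real.exp (p.2 * G.rbar)), ENNReal.ofReal_lt_top, fun c => ?_⟩
    change (ENNReal.ofReal _ • G.Q (p.1, c.1, c.2)) univ ≤ _
    rw [Measure.smul_apply, measure_univ, smul_eq_mul, mul_one]
    exact ENNReal.ofReal_le_ofReal (G.exp_mul_r_le p.2 _)
  change ∫ x', v (x', G.discount 1 p.2) ∂(((μ : Measure A).prod (ν : Measure B)).bind K) = _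
  have hcomp := Kernel.integral_comp (η := K) (a := ())
    (κ := Kernel.const Unit ((μ : Measure A).prod (ν : Measure B)))
    (integrable_comp_discount _ v p.2)
  rw [Kernel.comp_apply, Kernel.const_apply] at hcomp
  rw [hcomp]
  refine integral_congr_ae (Eventually.of_forall fun c => ?_)
  change ∫ x', v (x', G.discount 1 p.2) ∂(ENNReal.ofReal _ • G.Q (p.1, c.1, c.2)) = _
  rw [integral_smul_measure, ENNReal.toReal_ofReal (Real.exp_pos _).le]
  rfl

theorem L_eq_mixedPayoff' (hG : G.ContinuityCompactness)
    (v : BoundedContinuousFunction (E × Ioc (0 : ℝ) G.γbar) ℝ) (p : E × Ioc (0 : ℝ) G.γbar) :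
    G.L v p = mixedPayoff (stagePayoff hG v) p := by
  funext μ ν
  exact L_eq_mixedPayoff hG v p μ ν

theorem range_decisionRuleA (hG : G.ContinuityCompactness) (x : E) :
    range (fun f : DecisionRule G.actA => f.1 x) = probOn (G.actA x) :=
  DecisionRule.range_apply G.exists_selectorA (fun x => (hG.isCompact_actA x).measurableSet) x

theorem range_decisionRuleB (hG : G.ContinuityCompactness) (x : E) :
    range (fun g : DecisionRule G.actB => g.1 x) = probOn (G.actB x) :=
  DecisionRule.range_apply G.exists_selectorB (fun x => (hG.isCompact_actB x).measurableSet) x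

theorem T_eq_iInf_iSup (hG : G.ContinuityCompactness)
    (v : BoundedContinuousFunction (E × Ioc (0 : ℝ) G.γbar) ℝ) (p : E × Ioc (0 : ℝ) G.γbar) :
    G.T v p = ⨅ ν : probOn (G.actB p.1), ⨆ μ : probOn (G.actA p.1), G.L v p μ ν := by
  obtain ⟨μ, ν, h⟩ := exists_isSaddle_mixedPayoff hG.isActionCorrespondence_A
    hG.isActionCorrespondence_B (stagePayoff hG v) p
  have hb := abs_mixedPayoff_le (stagePayoff hG v) p
  rw [← L_eq_mixedPayoff'] at h hb
  rw [h.iInf_iSup_eq Subtype.range_coe Subtype.range_coe hb]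
  exact h.iInf_iSup_eq (range_decisionRuleA hG p.1) (range_decisionRuleB hG p.1) hb

theorem T_eq_mixedValue (hG : G.ContinuityCompactness)
    (v : BoundedContinuousFunction (E × Ioc (0 : ℝ) G.γbar) ℝ) (p : E × Ioc (0 : ℝ) G.γbar) :
    G.T v p = mixedValue (stagePayoff hG v) (fun p => G.actA p.1) (fun p => G.actB p.1) p := by
  rw [T_eq_iInf_iSup hG, L_eq_mixedPayoff' hG]
  rfl

theorem T_eq_of_isSaddle (hG : G.ContinuityCompactness)
    {v : BoundedContinuousFunction (E × Ioc (0 : ℝ) G.γbar) ℝ} {p : E × Ioc (0 : ℝ) G.γbar}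
    {μ : ProbabilityMeasure A} {ν : ProbabilityMeasure B}
    (h : IsSaddle (probOn (G.actA p.1)) (probOn (G.actB p.1)) (G.L v p) μ ν) :
    G.T v p = G.L v p μ ν := by
  rw [L_eq_mixedPayoff' hG v p] at h ⊢
  rw [T_eq_mixedValue hG v p]
  exact mixedValue_eq_of_isSaddle (u := stagePayoff hG v) (p := p) (SA := fun p => G.actA p.1) (SB := fun p => G.actB p.1) h

theorem exists_isSaddleSelector (hG : G.ContinuityCompactness)
    (v : BoundedContinuousFunction (E × Ioc (0 : ℝ) G.γbar) ℝ) :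
    ∃ (μ : RSGame.Selector G.γbar G.actA) (ν : RSGame.Selector G.γbar G.actB),
      G.IsSaddleSelector v μ ν := by
  obtain ⟨μ, ν, hμ, hν, h⟩ := exists_measurable_isSaddle hG.isActionCorrespondence_A
    hG.isActionCorrespondence_B (stagePayoff hG v)
  refine ⟨⟨μ, hμ, fun p => (h p).1⟩, ⟨ν, hν, fun p => (h p).2.1⟩, fun p => ?_⟩
  rw [L_eq_mixedPayoff' hG]
  exact h p

theorem continuous_T (hG : G.ContinuityCompactness)
    (v : BoundedContinuousFunction (E × Ioc (0 : ℝ) G.γbar) ℝ) : Continuous (G.T v) := by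
  rw [show G.T v = _ from funext (T_eq_mixedValue hG v)]
  exact continuous_mixedValue hG.isActionCorrespondence_A hG.isActionCorrespondence_B _

theorem T_le_mul (hG : G.ContinuityCompactness)
    {v w : BoundedContinuousFunction (E × Ioc (0 : ℝ) G.γbar) ℝ} {p : E × Ioc (0 : ℝ) G.γbar}
    {k : ℝ} (hk : 0 ≤ k)
    (h : ∀ x', v (x', G.discount 1 p.2) ≤ k * w (x', G.discount 1 p.2)) :
    G.T v p ≤ k * G.T w p := by
  rw [T_eq_mixedValue hG, T_eq_mixedValue hG]
  refine mixedValue_le_mul hG.isActionCorrespondence_A hG.isActionCorrespondence_B hk fun c => ?_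
  rw [stagePayoff_apply, stagePayoff_apply, mul_left_comm]
  refine mul_le_mul_of_nonneg_left ?_ (Real.exp_pos _).le
  rw [← integral_const_mul]
  exact integral_mono (integrable_comp_discount (G.Q (p.1, c)) v p.2)
    ((integrable_comp_discount (G.Q (p.1, c)) w p.2).const_mul k) h

theorem le_T (hG : G.ContinuityCompactness)
    {v : BoundedContinuousFunction (E × Ioc (0 : ℝ) G.γbar) ℝ} {p : E × Ioc (0 : ℝ) G.γbar}
    {m : ℝ} (hm : 0 ≤ m) (h : ∀ x', m ≤ v (x', G.discount 1 p.2)) : m ≤ G.T v p := by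
  rw [T_eq_mixedValue hG]
  refine le_mixedValue hG.isActionCorrespondence_A hG.isActionCorrespondence_B fun c => ?_
  rw [stagePayoff_apply]
  have h1 : m ≤ ∫ x', v (x', G.discount 1 p.2) ∂G.Q (p.1, c) := by
    refine le_trans ?_ (integral_mono (integrable_const m) (integrable_comp_discount _ v _) h)
    simp
  exact h1.trans (le_mul_of_one_le_left (hm.trans h1) (G.one_le_exp_mul_r p.2 _))

theorem T_le (hG : G.ContinuityCompactness)
    {v : BoundedContinuousFunction (E × Ioc (0 : ℝ) G.γbar) ℝ} {p : E × Ioc (0 : ℝ) G.γbar}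
    {m : ℝ} (hm : 0 ≤ m) (h : ∀ x', v (x', G.discount 1 p.2) ≤ m) :
    G.T v p ≤ Real.exp (p.2 * G.rbar) * m := by
  rw [T_eq_mixedValue hG]
  refine mixedValue_le hG.isActionCorrespondence_A hG.isActionCorrespondence_B fun c => ?_
  rw [stagePayoff_apply]
  have h1 : ∫ x', v (x', G.discount 1 p.2) ∂G.Q (p.1, c) ≤ m := by
    refine (integral_mono (integrable_comp_discount _ v _) (integrable_const m) h).trans ?_
    simp
  exact (mul_le_mul_of_nonneg_left h1 (Real.exp_pos _).le).trans
    (mul_le_mul_of_nonneg_right (G.exp_mul_r_le p.2 _) hm)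

end

end RSGame

/-! ### The fixed point of the Shapley operator -/

namespace RSGame

section

variable {E A B : Type*}
    [TopologicalSpace E] [TopologicalSpace.MetrizableSpace E] [SecondCountableTopology E]
    [MeasurableSpace E] [BorelSpace E]
    [TopologicalSpace A] [TopologicalSpace.MetrizableSpace A] [SecondCountableTopology A]
    [MeasurableSpace A] [BorelSpace A]
    [TopologicalSpace B] [TopologicalSpace.MetrizableSpace B] [SecondCountableTopology B]
    [MeasurableSpace B] [BorelSpace B]
    {G : RSGame E A B}

/-- The function `exp(γ h(x,γ))`, whose certainty equivalent is `h`. -/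
noncomputable def expTransform (h : BoundedContinuousFunction (E × Ioc (0 : ℝ) G.γbar) ℝ) :
    BoundedContinuousFunction (E × Ioc (0 : ℝ) G.γbar) ℝ :=
  BoundedContinuousFunction.ofNormedAddCommGroup (fun p => Real.exp (p.2 * h p)) (by fun_prop)
    (Real.exp (G.γbar * ‖h‖)) (fun p => by
      rw [Real.norm_eq_abs, Real.abs_exp]
      refine Real.exp_le_exp.2 ((mul_le_mul_of_nonneg_left ((le_abs_self _).trans
        (h.norm_coe_le_norm p)) p.2.2.1.le).trans ?_)
      exact mul_le_mul_of_nonneg_right p.2.2.2 (norm_nonneg h))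

theorem expTransform_apply (h : BoundedContinuousFunction (E × Ioc (0 : ℝ) G.γbar) ℝ)
    (p : E × Ioc (0 : ℝ) G.γbar) : expTransform h p = Real.exp (p.2 * h p) := rfl

/-- If `h` takes values in `[m, M]`, then `γ⁻¹ log T(exp(γ h))` takes values in
`[β m, rbar + β M]`. -/
theorem exp_le_T_expTransform_le (hG : G.ContinuityCompactness)
    {h : BoundedContinuousFunction (E × Ioc (0 : ℝ) G.γbar) ℝ} {m M : ℝ}
    (hm : ∀ p, m ≤ h p) (hM : ∀ p, h p ≤ M) (p : E × Ioc (0 : ℝ) G.γbar) :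
    Real.exp (p.2 * (G.β * m)) ≤ G.T (expTransform h) p ∧
      G.T (expTransform h) p ≤ Real.exp (p.2 * (G.rbar + G.β * M)) := by
  have hpos : 0 ≤ (G.discount 1 p.2 : ℝ) := (G.discount 1 p.2).2.1.le
  constructor
  · refine le_T hG (Real.exp_pos _).le fun x' => ?_
    rw [expTransform_apply, ← mul_assoc, ← coe_discount_one]
    exact Real.exp_le_exp.2 (mul_le_mul_of_nonneg_left (hm _) hpos)
  · rw [mul_add, Real.exp_add]
    refine T_le hG (Real.exp_pos _).le fun x' => ?_
    rw [expTransform_apply, ← mul_assoc, ← coe_discount_one]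
    exact Real.exp_le_exp.2 (mul_le_mul_of_nonneg_left (hM _) hpos)

theorem T_expTransform_pos (hG : G.ContinuityCompactness)
    (h : BoundedContinuousFunction (E × Ioc (0 : ℝ) G.γbar) ℝ) (p : E × Ioc (0 : ℝ) G.γbar) :
    0 < G.T (expTransform h) p :=
  (Real.exp_pos _).trans_le (exp_le_T_expTransform_le hG
    (fun p => (abs_le.1 (h.norm_coe_le_norm p)).1) (fun p => (abs_le.1 (h.norm_coe_le_norm p)).2)
    p).1

/-- The Shapley operator in terms of certainty equivalents, `h ↦ γ⁻¹ log T(exp(γ h))`. -/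
noncomputable def logShapley (hG : G.ContinuityCompactness)
    (h : BoundedContinuousFunction (E × Ioc (0 : ℝ) G.γbar) ℝ) :
    BoundedContinuousFunction (E × Ioc (0 : ℝ) G.γbar) ℝ :=
  BoundedContinuousFunction.ofNormedAddCommGroup
    (fun p => (p.2 : ℝ)⁻¹ * Real.log (G.T (expTransform h) p))
    ((Continuous.inv₀ (by fun_prop) fun p => p.2.2.1.ne').mul
      ((continuous_T hG _).log fun p => (T_expTransform_pos hG h p).ne'))
    (|G.rbar| + G.β * ‖h‖) (fun p => by
      obtain ⟨h1, h2⟩ := exp_le_T_expTransform_le hG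
        (fun p => (abs_le.1 (h.norm_coe_le_norm p)).1)
        (fun p => (abs_le.1 (h.norm_coe_le_norm p)).2) p
      have hpos := T_expTransform_pos hG h p
      rw [← Real.le_log_iff_exp_le hpos] at h1
      rw [← Real.log_le_iff_le_exp hpos] at h2
      have hγ : (0 : ℝ) < p.2 := p.2.2.1
      rw [Real.norm_eq_abs, abs_le]
      constructor
      · rw [← mul_le_mul_iff_right₀ hγ, mul_inv_cancel_left₀ hγ.ne']
        refine le_trans (mul_le_mul_of_nonneg_left ?_ hγ.le) h1
        linarith [abs_nonneg G.rbar]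
      · rw [← mul_le_mul_iff_right₀ hγ, mul_inv_cancel_left₀ hγ.ne']
        refine h2.trans (mul_le_mul_of_nonneg_left ?_ hγ.le)
        linarith [le_abs_self G.rbar])

theorem exp_mul_logShapley (hG : G.ContinuityCompactness)
    (h : BoundedContinuousFunction (E × Ioc (0 : ℝ) G.γbar) ℝ) (p : E × Ioc (0 : ℝ) G.γbar) :
    Real.exp (p.2 * logShapley hG h p) = G.T (expTransform h) p := by
  change Real.exp (p.2 * ((p.2 : ℝ)⁻¹ * Real.log (G.T (expTransform h) p))) = _
  rw [mul_inv_cancel_left₀ p.2.2.1.ne', Real.exp_log (T_expTransform_pos hG h p)]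

theorem logShapley_le_add (hG : G.ContinuityCompactness)
    {h h' : BoundedContinuousFunction (E × Ioc (0 : ℝ) G.γbar) ℝ} {d : ℝ}
    (hd : ∀ p, h p ≤ h' p + d) (p : E × Ioc (0 : ℝ) G.γbar) :
    logShapley hG h p ≤ logShapley hG h' p + G.β * d := by
  have hγ : (0 : ℝ) < p.2 := p.2.2.1
  rw [← mul_le_mul_iff_right₀ hγ, ← Real.exp_le_exp, mul_add, add_comm, Real.exp_add,
    exp_mul_logShapley, exp_mul_logShapley]
  refine T_le_mul hG (Real.exp_pos _).le fun x' => ?_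
  rw [expTransform_apply, expTransform_apply, ← Real.exp_add, ← mul_assoc, ← coe_discount_one,
    ← mul_add, add_comm d]
  exact Real.exp_le_exp.2 (mul_le_mul_of_nonneg_left (hd _) (G.discount 1 p.2).2.1.le)

/-- In terms of certainty equivalents the Shapley operator is a `β`-contraction for the sup norm:
the continuation is evaluated at the risk parameter `βγ`. -/
theorem contracting_logShapley (hG : G.ContinuityCompactness) (hβ : G.β < 1) :
    ContractingWith ⟨G.β, G.β_pos.le⟩ (logShapley hG) := by
  refine ⟨by exact_mod_cast hβ, LipschitzWith.of_dist_le_mul fun h h' => ?_⟩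
  change _ ≤ G.β * dist h h'
  rw [BoundedContinuousFunction.dist_le (mul_nonneg G.β_pos.le dist_nonneg)]
  intro p
  have hd : ∀ q, |h q - h' q| ≤ dist h h' := fun q => by
    rw [← Real.dist_eq]; exact BoundedContinuousFunction.dist_coe_le_dist q
  rw [Real.dist_eq, abs_le]
  constructor
  · have := logShapley_le_add hG (h := h') (h' := h) (d := dist h h')
      (fun q => by linarith [(abs_le.1 (hd q)).1]) p
    linarith
  · have := logShapley_le_add hG (h := h) (h' := h') (d := dist h h')
      (fun q => by linarith [(abs_le.1 (hd q)).2]) p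
    linarith

/-- The Shapley equation has a continuous solution between the bounds for the total reward. The
bounds `0 ≤ h ≤ rbar/(1-β)` for the fixed point `h` hold since each application of the operator
contracts the distance to `[0, rbar/(1-β)]` by the factor `β`. -/
theorem exists_T_eq_self (hG : G.ContinuityCompactness) (hβ : G.β < 1) :
    ∃ v : BoundedContinuousFunction (E × Ioc (0 : ℝ) G.γbar) ℝ, (∀ p, G.T v p = v p) ∧
      ∀ p, 1 ≤ v p ∧ v p ≤ Real.exp (p.2 * (G.rbar / (1 - G.β))) := by
  have hc := contracting_logShapley hG hβ
  have : Nonempty (BoundedContinuousFunction (E × Ioc (0 : ℝ) G.γbar) ℝ) := ⟨0⟩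
  obtain ⟨h, hfix⟩ : ∃ h, logShapley hG h = h := ⟨_, hc.fixedPoint_isFixedPt⟩
  have hT : ∀ p, G.T (expTransform h) p = expTransform h p := fun p => by
    rw [expTransform_apply]
    conv_rhs => rw [← hfix]
    exact (exp_mul_logShapley hG h p).symm
  set R := G.rbar / (1 - G.β) with hR
  have hRβ : G.rbar + G.β * R = R := by
    have : 1 - G.β ≠ 0 := by linarith
    rw [hR]
    field_simp
    ring
  have hstep : ∀ k, (∀ p, -k ≤ h p ∧ h p ≤ R + k) →
      ∀ p, -(G.β * k) ≤ h p ∧ h p ≤ R + G.β * k := by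
    intro k hk p
    obtain ⟨h1, h2⟩ := exp_le_T_expTransform_le hG (fun p => (hk p).1) (fun p => (hk p).2) p
    have hγ : (0 : ℝ) < p.2 := p.2.2.1
    rw [hT, expTransform_apply, Real.exp_le_exp, mul_le_mul_iff_right₀ hγ] at h1 h2
    constructor
    · linarith
    · linarith
  have hiter : ∀ n : ℕ, ∀ p, -(G.β ^ n * (‖h‖ + |R|)) ≤ h p ∧
      h p ≤ R + G.β ^ n * (‖h‖ + |R|) := by
    intro n
    induction n with
    | zero =>
      intro p
      have := abs_le.1 (h.norm_coe_le_norm p)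
      have h1 := neg_abs_le R
      have h2 := abs_nonneg R
      rw [pow_zero, one_mul]
      constructor <;> linarith
    | succ n ih =>
      intro p
      rw [pow_succ', mul_assoc]
      exact hstep _ ih p
  have hlim : Tendsto (fun n : ℕ => G.β ^ n * (‖h‖ + |R|)) atTop (𝓝 0) := by
    simpa using (tendsto_pow_atTop_nhds_zero_of_lt_one G.β_pos.le hβ).mul_const (‖h‖ + |R|)
  refine ⟨expTransform h, hT, fun p => ⟨?_, ?_⟩⟩
  · refine Real.one_le_exp (mul_nonneg p.2.2.1.le ?_)
    exact le_of_tendsto' (by simpa using hlim.neg) (fun n => (hiter n p).1)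
  · refine Real.exp_le_exp.2 (mul_le_mul_of_nonneg_left ?_ p.2.2.1.le)
    exact ge_of_tendsto' (by simpa using hlim.const_add R) (fun n => (hiter n p).2)

end

end RSGame

/-! ### One-step decompositions of the law of the process -/

namespace RSGame

section

variable {E A B : Type*} [MeasurableSpace E] [MeasurableSpace A] [MeasurableSpace B]
  (G : RSGame E A B) (π : Policy G.actA) (σ : Policy G.actB) (x : E)

instance : IsProbabilityMeasure (G.law π σ x) := by
  unfold law; infer_instance

theorem lintegral_stageKernel (f : DecisionRule G.actA) (g : DecisionRule G.actB) (x : E)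
    {u : E × A × B → ENNReal} (hu : Measurable u) :
    ∫⁻ z, u z ∂G.stageKernel f g x =
      ∫⁻ c, u (x, c) ∂(f.1 x : Measure A).prod (g.1 x : Measure B) := by
  rw [stageKernel, Kernel.lintegral_id_prod hu, Kernel.prod_apply]
  rfl

theorem lintegral_stageKernel_fst (f : DecisionRule G.actA) (g : DecisionRule G.actB) (x : E)
    {k : E → ENNReal} (hk : Measurable k) : ∫⁻ z, k z.1 ∂G.stageKernel f g x = k x := by
  rw [lintegral_stageKernel G f g x (u := fun z => k z.1) (hk.comp measurable_fst)]
  simp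

theorem lintegral_stepKernel (n : ℕ) (h : Π _ : Finset.Iic n, E × A × B)
    {u : E × A × B → ENNReal} (hu : Measurable u) :
    ∫⁻ z, u z ∂G.stepKernel π σ n h =
      ∫⁻ x', ∫⁻ z, u z ∂G.stageKernel (π (n + 1)) (σ (n + 1)) x'
        ∂G.Q (h ⟨n, Finset.mem_Iic.2 le_rfl⟩) := by
  rw [stepKernel, Kernel.lintegral_comp _ _ _ hu]
  rfl

theorem lintegral_law_zero {u : E × A × B → ENNReal} (hu : Measurable u) :
    ∫⁻ ω, u (ω 0) ∂G.law π σ x = ∫⁻ z, u z ∂G.stageKernel (π 0) (σ 0) x := by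
  have hu0 : Measurable fun ω : ℕ → E × A × B => u (ω 0) := hu.comp (measurable_pi_apply 0)
  rw [law, Kernel.trajMeasure, Measure.lintegral_bind (Kernel.aemeasurable _) hu0.aemeasurable,
    lintegral_map hu0.lintegral_kernel (by fun_prop)]
  refine lintegral_congr fun z => ?_
  rw [Kernel.lintegral_traj _ hu0]
  simp [Function.updateFinset]

theorem lintegral_law_succ (n : ℕ)
    {F : (Π _ : Finset.Iic n, E × A × B) × (E × A × B) → ENNReal} (hF : Measurable F) :
    ∫⁻ ω, F (Preorder.frestrictLe n ω, ω (n + 1)) ∂G.law π σ x =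
      ∫⁻ ω, ∫⁻ z, F (Preorder.frestrictLe n ω, z)
        ∂G.stepKernel π σ n (Preorder.frestrictLe n ω) ∂G.law π σ x := by
  have h := Kernel.map_frestrictLe_trajMeasure_compProd_eq_map_trajMeasure
    (X := fun _ => E × A × B) (μ₀ := G.stageKernel (π 0) (σ 0) x) (κ := G.stepKernel π σ) (a := n)
  change (G.law π σ x).map _ ⊗ₘ _ = (G.law π σ x).map _ at h
  have h1 := congrArg (fun m => ∫⁻ y, F y ∂m) h
  rw [Measure.lintegral_compProd hF, lintegral_map hF (by fun_prop), lintegral_map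
    (Measurable.lintegral_kernel_prod_right' hF) (by fun_prop)] at h1
  exact h1.symm

/-- The exponential utility `exp(γ ∑_{k<n} βᵏ r_k)` accumulated before stage `n`. -/
noncomputable def weight (γ : ℝ) (n : ℕ) (ω : ℕ → E × A × B) : ENNReal :=
  ENNReal.ofReal (Real.exp (γ * ∑ k ∈ Finset.range n, G.β ^ k * G.r (ω k)))

theorem measurable_weight (γ : ℝ) (n : ℕ) : Measurable (G.weight γ n) := by
  have := G.measurable_r
  unfold weight
  fun_prop

theorem weight_succ (γ : ℝ) (n : ℕ) (ω : ℕ → E × A × B) :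
    G.weight γ (n + 1) ω =
      G.weight γ n ω * ENNReal.ofReal (Real.exp (γ * G.β ^ n * G.r (ω n))) := by
  rw [weight, weight, ← ENNReal.ofReal_mul (Real.exp_pos _).le, ← Real.exp_add,
    Finset.sum_range_succ, mul_add, mul_assoc γ]

/-- The weight before stage `n + 1` is a function of the history up to stage `n`. -/
theorem weight_succ_eq_comp_frestrictLe (γ : ℝ) (n : ℕ) (ω : ℕ → E × A × B) :
    G.weight γ (n + 1) ω = G.weight γ (n + 1) fun k =>
      Preorder.frestrictLe n ω ⟨min k n, Finset.mem_Iic.2 (min_le_right k n)⟩ := by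
  unfold weight
  congr 3
  refine Finset.sum_congr rfl fun k hk => ?_
  change _ = _ * G.r (ω (min k n))
  rw [min_eq_left (Nat.lt_succ_iff.1 (Finset.mem_range.1 hk))]

theorem lintegral_weight_succ_mul (γ : ℝ) (n : ℕ) {u : E × A × B → ENNReal} (hu : Measurable u) :
    ∫⁻ ω, G.weight γ (n + 1) ω * u (ω (n + 1)) ∂G.law π σ x =
      ∫⁻ ω, G.weight γ (n + 1) ω *
        ∫⁻ x', ∫⁻ z, u z ∂G.stageKernel (π (n + 1)) (σ (n + 1)) x' ∂G.Q (ω n) ∂G.law π σ x := by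
  let W : (Π _ : Finset.Iic n, E × A × B) → ENNReal := fun h =>
    G.weight γ (n + 1) fun k => h ⟨min k n, Finset.mem_Iic.2 (min_le_right k n)⟩
  have hW : Measurable W := (G.measurable_weight γ (n + 1)).comp
    (measurable_pi_lambda _ fun k => measurable_pi_apply _)
  have h := G.lintegral_law_succ π σ x n (F := fun y => W y.1 * u y.2)
    ((hW.comp measurable_fst).mul (hu.comp measurable_snd))
  have hWω : ∀ ω, W (Preorder.frestrictLe n ω) = G.weight γ (n + 1) ω := fun ω =>
    (G.weight_succ_eq_comp_frestrictLe γ n ω).symm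
  simp only [hWω] at h
  rw [h]
  refine lintegral_congr fun ω => ?_
  rw [lintegral_const_mul _ hu, G.lintegral_stepKernel π σ n _ hu]
  rfl

/-- Given the history before stage `n` and the state `X_n`, the actions may be averaged out. -/
theorem lintegral_weight_mul_stage (γ : ℝ) (n : ℕ) {u : E × A × B → ENNReal} (hu : Measurable u) :
    ∫⁻ ω, G.weight γ n ω * u (ω n) ∂G.law π σ x =
      ∫⁻ ω, G.weight γ n ω * ∫⁻ z, u z ∂G.stageKernel (π n) (σ n) (ω n).1 ∂G.law π σ x := by
  have hm : Measurable fun x' => ∫⁻ z, u z ∂G.stageKernel (π n) (σ n) x' := hu.lintegral_kernel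
  cases n with
  | zero =>
    have h0 : ∀ ω, G.weight γ 0 ω = 1 := fun ω => by simp [weight]
    simp only [h0, one_mul]
    rw [G.lintegral_law_zero π σ x hu, G.lintegral_law_zero π σ x
        (u := fun z => ∫⁻ z', u z' ∂G.stageKernel (π 0) (σ 0) z.1) (hm.comp measurable_fst),
      G.lintegral_stageKernel_fst _ _ x hm]
  | succ n =>
    rw [G.lintegral_weight_succ_mul π σ x γ n hu,
      G.lintegral_weight_succ_mul π σ x γ n
        (u := fun z => ∫⁻ z', u z' ∂G.stageKernel (π (n + 1)) (σ (n + 1)) z.1)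
        (hm.comp measurable_fst)]
    refine lintegral_congr fun ω => ?_
    congr 1
    refine lintegral_congr fun x' => ?_
    exact (G.lintegral_stageKernel_fst _ _ x' hm).symm

theorem lintegral_weight_succ_mul_fst (γ : ℝ) (n : ℕ) {k : E → ENNReal} (hk : Measurable k) :
    ∫⁻ ω, G.weight γ (n + 1) ω * k (ω (n + 1)).1 ∂G.law π σ x =
      ∫⁻ ω, G.weight γ n ω * (ENNReal.ofReal (Real.exp (γ * G.β ^ n * G.r (ω n))) *
        ∫⁻ x', k x' ∂G.Q (ω n)) ∂G.law π σ x := by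
  rw [G.lintegral_weight_succ_mul π σ x γ n (u := fun z => k z.1) (hk.comp measurable_fst)]
  refine lintegral_congr fun ω => ?_
  rw [weight_succ, mul_assoc]
  congr 2
  exact lintegral_congr fun x' => G.lintegral_stageKernel_fst _ _ x' hk

/-! ### Total discounted rewards -/

theorem summable_reward (hβ : G.β < 1) (ω : ℕ → E × A × B) :
    Summable fun k => G.β ^ k * G.r (ω k) :=
  Summable.of_nonneg_of_le (fun k => mul_nonneg (pow_nonneg G.β_pos.le k) (G.r_nonneg _))
    (fun k => mul_le_mul_of_nonneg_left (G.r_le _) (pow_nonneg G.β_pos.le k))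
    ((summable_geometric_of_lt_one G.β_pos.le hβ).mul_right G.rbar)

theorem sum_le_tsum_reward (hβ : G.β < 1) (n : ℕ) (ω : ℕ → E × A × B) :
    ∑ k ∈ Finset.range n, G.β ^ k * G.r (ω k) ≤ ∑' k, G.β ^ k * G.r (ω k) :=
  (G.summable_reward hβ ω).sum_le_tsum _ fun k _ =>
    mul_nonneg (pow_nonneg G.β_pos.le k) (G.r_nonneg _)

theorem tsum_reward_le (hβ : G.β < 1) (n : ℕ) (ω : ℕ → E × A × B) :
    ∑' k, G.β ^ k * G.r (ω k) ≤
      G.β ^ n * (G.rbar / (1 - G.β)) + ∑ k ∈ Finset.range n, G.β ^ k * G.r (ω k) := by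
  have hs := G.summable_reward hβ ω
  rw [← hs.sum_add_tsum_nat_add n, add_comm]
  gcongr
  have hg := (hasSum_geometric_of_lt_one G.β_pos.le hβ).mul_left (G.β ^ n * G.rbar)
  rw [div_eq_mul_inv, ← mul_assoc, ← hg.tsum_eq]
  refine Summable.tsum_le_tsum (fun k => ?_) ((summable_nat_add_iff n).2 hs) hg.summable
  rw [pow_add, mul_comm (G.β ^ k), mul_right_comm _ G.rbar]
  exact mul_le_mul_of_nonneg_left (G.r_le _)
    (mul_nonneg (pow_nonneg G.β_pos.le n) (pow_nonneg G.β_pos.le k))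

theorem measurable_tsum_reward (hβ : G.β < 1) :
    Measurable fun ω : ℕ → E × A × B => ∑' k, G.β ^ k * G.r (ω k) := by
  have := G.measurable_r
  refine measurable_of_tendsto_metrizable
    (f := fun n (ω : ℕ → E × A × B) => ∑ k ∈ Finset.range n, G.β ^ k * G.r (ω k))
    (fun n => by fun_prop) (tendsto_pi_nhds.2 fun ω => ?_)
  exact (G.summable_reward hβ ω).hasSum.tendsto_sum_nat

variable (γ : Ioc (0 : ℝ) G.γbar)

theorem exp_tsum_le (hβ : G.β < 1) (n : ℕ) (ω : ℕ → E × A × B) :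
    Real.exp (γ * ∑' k, G.β ^ k * G.r (ω k)) ≤
      Real.exp (γ * G.β ^ n * (G.rbar / (1 - G.β))) *
        Real.exp (γ * ∑ k ∈ Finset.range n, G.β ^ k * G.r (ω k)) := by
  rw [← Real.exp_add, mul_assoc, ← mul_add]
  exact Real.exp_le_exp.2 (mul_le_mul_of_nonneg_left (G.tsum_reward_le hβ n ω) γ.2.1.le)

theorem exp_sum_le (hβ : G.β < 1) (n : ℕ) (ω : ℕ → E × A × B) :
    Real.exp (γ * ∑ k ∈ Finset.range n, G.β ^ k * G.r (ω k)) ≤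
      Real.exp (γ * ∑' k, G.β ^ k * G.r (ω k)) :=
  Real.exp_le_exp.2 (mul_le_mul_of_nonneg_left (G.sum_le_tsum_reward hβ n ω) γ.2.1.le)

theorem integrable_exp_tsum (hβ : G.β < 1) :
    Integrable (fun ω => Real.exp (γ * ∑' k, G.β ^ k * G.r (ω k))) (G.law π σ x) := by
  refine Integrable.of_bound
    (((G.measurable_tsum_reward hβ).const_mul _).exp).aestronglyMeasurable
    (Real.exp (γ * G.β ^ 0 * (G.rbar / (1 - G.β)))) (Eventually.of_forall fun ω => ?_)
  rw [Real.norm_eq_abs, Real.abs_exp]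
  simpa using G.exp_tsum_le γ hβ 0 ω

theorem integrable_exp_sum (hβ : G.β < 1) (n : ℕ) :
    Integrable (fun ω => Real.exp (γ * ∑ k ∈ Finset.range n, G.β ^ k * G.r (ω k)))
      (G.law π σ x) := by
  have := G.measurable_r
  refine (G.integrable_exp_tsum π σ x γ hβ).mono'
    (by fun_prop : Measurable _).aestronglyMeasurable (Eventually.of_forall fun ω => ?_)
  rw [Real.norm_eq_abs, Real.abs_exp]
  exact G.exp_sum_le γ hβ n ω

theorem payoff_le_payoffInf (hβ : G.β < 1) (n : ℕ) :
    G.payoff n π σ (x, γ) ≤ G.payoffInf π σ (x, γ) :=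
  integral_mono (G.integrable_exp_sum π σ x γ hβ n) (G.integrable_exp_tsum π σ x γ hβ)
    (G.exp_sum_le γ hβ n)

theorem payoffInf_le_mul_payoff (hβ : G.β < 1) (n : ℕ) :
    G.payoffInf π σ (x, γ) ≤
      Real.exp (γ * G.β ^ n * (G.rbar / (1 - G.β))) * G.payoff n π σ (x, γ) := by
  rw [payoff, ← integral_const_mul]
  exact integral_mono (G.integrable_exp_tsum π σ x γ hβ)
    ((G.integrable_exp_sum π σ x γ hβ n).const_mul _) (G.exp_tsum_le γ hβ n)

theorem payoff_zero : G.payoff 0 π σ (x, γ) = 1 := by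
  simp [payoff]

theorem one_le_payoffInf (hβ : G.β < 1) : 1 ≤ G.payoffInf π σ (x, γ) :=
  (G.payoff_zero π σ x γ).symm.le.trans (G.payoff_le_payoffInf π σ x γ hβ 0)

theorem payoffInf_le (hβ : G.β < 1) :
    G.payoffInf π σ (x, γ) ≤ Real.exp (γ * (G.rbar / (1 - G.β))) := by
  simpa [payoff_zero] using G.payoffInf_le_mul_payoff π σ x γ hβ 0

theorem ofReal_payoff (hβ : G.β < 1) (n : ℕ) :
    ENNReal.ofReal (G.payoff n π σ (x, γ)) = ∫⁻ ω, G.weight γ n ω ∂G.law π σ x :=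
  ofReal_integral_eq_lintegral_ofReal (G.integrable_exp_sum π σ x γ hβ n)
    (Eventually.of_forall fun _ => (Real.exp_pos _).le)

theorem payoff_nonneg (n : ℕ) : 0 ≤ G.payoff n π σ (x, γ) :=
  integral_nonneg fun _ => (Real.exp_pos _).le

end

section

variable {E A B : Type*}
    [TopologicalSpace E] [TopologicalSpace.MetrizableSpace E] [SecondCountableTopology E]
    [MeasurableSpace E] [BorelSpace E]
    [TopologicalSpace A] [TopologicalSpace.MetrizableSpace A] [SecondCountableTopology A]
    [MeasurableSpace A] [BorelSpace A]
    [TopologicalSpace B] [TopologicalSpace.MetrizableSpace B] [SecondCountableTopology B]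
    [MeasurableSpace B] [BorelSpace B]
    {G : RSGame E A B}

/-! ### Verification -/

theorem discount_one_discount (n : ℕ) (γ : Ioc (0 : ℝ) G.γbar) :
    G.discount 1 (G.discount n γ) = G.discount (n + 1) γ := by
  apply Subtype.ext
  simp [discount, pow_succ, mul_assoc]

theorem discount_zero (γ : Ioc (0 : ℝ) G.γbar) : G.discount 0 γ = γ := by
  apply Subtype.ext
  simp [discount]

theorem ofReal_stagePayoff (hG : G.ContinuityCompactness)
    {v : BoundedContinuousFunction (E × Ioc (0 : ℝ) G.γbar) ℝ} (hv : ∀ p, 0 ≤ v p)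
    (z : (E × Ioc (0 : ℝ) G.γbar) × A × B) :
    ENNReal.ofReal (stagePayoff hG v z) = ENNReal.ofReal (Real.exp (z.1.2 * G.r (z.1.1, z.2))) *
      ∫⁻ x', ENNReal.ofReal (v (x', G.discount 1 z.1.2)) ∂G.Q (z.1.1, z.2) := by
  rw [stagePayoff_apply, ENNReal.ofReal_mul (Real.exp_pos _).le,
    ofReal_integral_eq_lintegral_ofReal (integrable_comp_discount _ v _)
      (Eventually.of_forall fun _ => hv _)]

theorem stagePayoff_nonneg (hG : G.ContinuityCompactness)
    {v : BoundedContinuousFunction (E × Ioc (0 : ℝ) G.γbar) ℝ} (hv : ∀ p, 0 ≤ v p)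
    (z : (E × Ioc (0 : ℝ) G.γbar) × A × B) : 0 ≤ stagePayoff hG v z :=
  mul_nonneg (Real.exp_pos _).le (integral_nonneg fun _ => hv _)

/-- The expectation of `exp(γ ∑_{k<n} βᵏ r_k) v(X_n, γβⁿ)`. -/
noncomputable def continuation (v : BoundedContinuousFunction (E × Ioc (0 : ℝ) G.γbar) ℝ)
    (π : Policy G.actA) (σ : Policy G.actB) (x : E) (γ : Ioc (0 : ℝ) G.γbar) (n : ℕ) : ENNReal :=
  ∫⁻ ω, G.weight γ n ω * ENNReal.ofReal (v ((ω n).1, G.discount n γ)) ∂G.law π σ x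

theorem continuation_zero (v : BoundedContinuousFunction (E × Ioc (0 : ℝ) G.γbar) ℝ)
    (π : Policy G.actA) (σ : Policy G.actB) (x : E) (γ : Ioc (0 : ℝ) G.γbar) :
    continuation v π σ x γ 0 = ENNReal.ofReal (v (x, γ)) := by
  have hm : Measurable fun x' : E => ENNReal.ofReal (v (x', γ)) :=
    (by fun_prop : Continuous fun x' : E => v (x', γ)).measurable.ennreal_ofReal
  simp only [continuation, weight, Finset.range_zero, Finset.sum_empty, mul_zero, Real.exp_zero,
    ENNReal.ofReal_one, one_mul, discount_zero]
  rw [G.lintegral_law_zero π σ x (u := fun z => ENNReal.ofReal (v (z.1, γ)))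
    (hm.comp measurable_fst), G.lintegral_stageKernel_fst _ _ x hm]

/-- Going back from stage `n + 1` to stage `n` applies the operator `L`. -/
theorem continuation_succ (hG : G.ContinuityCompactness)
    {v : BoundedContinuousFunction (E × Ioc (0 : ℝ) G.γbar) ℝ} (hv : ∀ p, 0 ≤ v p)
    (π : Policy G.actA) (σ : Policy G.actB) (x : E) (γ : Ioc (0 : ℝ) G.γbar) (n : ℕ) :
    continuation v π σ x γ (n + 1) = ∫⁻ ω, G.weight γ n ω * ENNReal.ofReal
      (G.L v ((ω n).1, G.discount n γ) ((π n).1 (ω n).1) ((σ n).1 (ω n).1)) ∂G.law π σ x := by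
  have hm : Measurable fun x' : E => ENNReal.ofReal (v (x', G.discount (n + 1) γ)) :=
    (by fun_prop : Continuous fun x' : E => v (x', G.discount (n + 1) γ)).measurable.ennreal_ofReal
  have hu : Measurable fun z : E × A × B =>
      ENNReal.ofReal (stagePayoff hG v ((z.1, G.discount n γ), z.2)) :=
    (by fun_prop : Continuous fun z : E × A × B =>
      stagePayoff hG v ((z.1, G.discount n γ), z.2)).measurable.ennreal_ofReal
  rw [continuation, G.lintegral_weight_succ_mul_fst π σ x γ n hm]
  have h1 : ∀ z : E × A × B, ENNReal.ofReal (Real.exp (γ * G.β ^ n * G.r z)) *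
      ∫⁻ x', ENNReal.ofReal (v (x', G.discount (n + 1) γ)) ∂G.Q z =
      ENNReal.ofReal (stagePayoff hG v ((z.1, G.discount n γ), z.2)) := by
    intro z
    rw [ofReal_stagePayoff hG hv, discount_one_discount]
    rfl
  simp only [h1]
  rw [G.lintegral_weight_mul_stage π σ x γ n hu]
  refine lintegral_congr fun ω => ?_
  rw [G.lintegral_stageKernel _ _ _ hu, L_eq_mixedPayoff hG, mixedPayoff,
    ofReal_integral_eq_lintegral_ofReal (integrable_section _ _ _)
      (Eventually.of_forall fun _ => stagePayoff_nonneg hG hv _)]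

/-- If `v ≥ 1` is superharmonic along a pair of policies, it dominates their payoff: the expectations
`continuation` decrease from `v(x,γ)` and dominate the finite horizon payoffs. -/
theorem payoffInf_le_of_forall_L_le (hG : G.ContinuityCompactness) (hβ : G.β < 1)
    {v : BoundedContinuousFunction (E × Ioc (0 : ℝ) G.γbar) ℝ} (hv : ∀ p, 1 ≤ v p)
    {π : Policy G.actA} {σ : Policy G.actB} {γ : Ioc (0 : ℝ) G.γbar}
    (h : ∀ n y, G.L v (y, G.discount n γ) ((π n).1 y) ((σ n).1 y) ≤ v (y, G.discount n γ))
    (x : E) : G.payoffInf π σ (x, γ) ≤ v (x, γ) := by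
  have hI : ∀ n, continuation v π σ x γ n ≤ ENNReal.ofReal (v (x, γ)) := by
    intro n
    induction n with
    | zero => exact (continuation_zero v π σ x γ).le
    | succ n ih =>
      rw [continuation_succ hG fun p => zero_le_one.trans (hv p)]
      refine le_trans (lintegral_mono fun ω => ?_) ih
      gcongr
      exact h n _
  have hpay : ∀ n, G.payoff n π σ (x, γ) ≤ v (x, γ) := by
    intro n
    rw [← ENNReal.ofReal_le_ofReal_iff (zero_le_one.trans (hv _)), G.ofReal_payoff π σ x γ hβ n]
    refine le_trans (lintegral_mono fun ω => ?_) (hI n)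
    refine le_mul_of_one_le_right zero_le ?_
    rw [← ENNReal.ofReal_one]
    exact ENNReal.ofReal_le_ofReal (hv _)
  have hlim : Tendsto (fun n : ℕ => Real.exp (γ * G.β ^ n * (G.rbar / (1 - G.β))) * v (x, γ)) atTop
      (𝓝 (Real.exp (γ * 0 * (G.rbar / (1 - G.β))) * v (x, γ))) :=
    ((Real.continuous_exp.tendsto _).comp (((tendsto_pow_atTop_nhds_zero_of_lt_one G.β_pos.le
      hβ).const_mul _).mul_const _)).mul_const _
  rw [mul_zero, zero_mul, Real.exp_zero, one_mul] at hlim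
  exact ge_of_tendsto' hlim fun n => (G.payoffInf_le_mul_payoff π σ x γ hβ n).trans
    (mul_le_mul_of_nonneg_left (hpay n) (Real.exp_pos _).le)

/-- If `v` is subharmonic along a pair of policies, it is dominated by their payoff: the expectations
`continuation` increase from `v(x,γ)`, and the upper bound for `v` makes the factor `v(X_n, γβⁿ)`
negligible in the limit. -/
theorem le_payoffInf_of_forall_le_L (hG : G.ContinuityCompactness) (hβ : G.β < 1)
    {v : BoundedContinuousFunction (E × Ioc (0 : ℝ) G.γbar) ℝ} (hv : ∀ p, 1 ≤ v p)
    (hv' : ∀ p, v p ≤ Real.exp (p.2 * (G.rbar / (1 - G.β))))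
    {π : Policy G.actA} {σ : Policy G.actB} {γ : Ioc (0 : ℝ) G.γbar}
    (h : ∀ n y, v (y, G.discount n γ) ≤ G.L v (y, G.discount n γ) ((π n).1 y) ((σ n).1 y))
    (x : E) : v (x, γ) ≤ G.payoffInf π σ (x, γ) := by
  have hI : ∀ n, ENNReal.ofReal (v (x, γ)) ≤ continuation v π σ x γ n := by
    intro n
    induction n with
    | zero => exact (continuation_zero v π σ x γ).ge
    | succ n ih =>
      rw [continuation_succ hG fun p => zero_le_one.trans (hv p)]
      refine ih.trans (lintegral_mono fun ω => ?_)
      gcongr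
      exact h n _
  have hpay : ∀ n, v (x, γ) ≤ G.payoff n π σ (x, γ) *
      Real.exp (γ * G.β ^ n * (G.rbar / (1 - G.β))) := by
    intro n
    rw [← ENNReal.ofReal_le_ofReal_iff (mul_nonneg (G.payoff_nonneg π σ x γ n)
      (Real.exp_pos _).le), ENNReal.ofReal_mul (G.payoff_nonneg π σ x γ n),
      G.ofReal_payoff π σ x γ hβ n, ← lintegral_mul_const _ (G.measurable_weight γ n)]
    refine (hI n).trans (lintegral_mono fun ω => ?_)
    gcongr
    exact hv' _
  have hlim : Tendsto (fun n : ℕ => G.payoffInf π σ (x, γ) *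
      Real.exp (γ * G.β ^ n * (G.rbar / (1 - G.β)))) atTop
      (𝓝 (G.payoffInf π σ (x, γ) * Real.exp (γ * 0 * (G.rbar / (1 - G.β))))) :=
    ((Real.continuous_exp.tendsto _).comp (((tendsto_pow_atTop_nhds_zero_of_lt_one G.β_pos.le
      hβ).const_mul _).mul_const _)).const_mul _
  rw [mul_zero, zero_mul, Real.exp_zero, mul_one] at hlim
  exact ge_of_tendsto' hlim fun n => (hpay n).trans
    (mul_le_mul_of_nonneg_right (G.payoff_le_payoffInf π σ x γ hβ n) (Real.exp_pos _).le)

end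

/-! ### Finite horizon approximation -/

section

variable {E A B : Type*} [MeasurableSpace E] [MeasurableSpace A] [MeasurableSpace B]
  (G : RSGame E A B)

theorem upperValue_le_upperValueInf (hβ : G.β < 1) (n : ℕ) (p : E × Ioc (0 : ℝ) G.γbar) :
    G.upperValue n p ≤ G.upperValueInf p := by
  refine ciInf_mono ⟨0, ?_⟩ fun σ => ciSup_mono
    ⟨Real.exp (p.2 * (G.rbar / (1 - G.β))), ?_⟩ fun π => G.payoff_le_payoffInf π σ p.1 p.2 hβ n
  · rintro _ ⟨σ, rfl⟩
    exact Real.iSup_nonneg fun π => G.payoff_nonneg π σ p.1 p.2 n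
  · rintro _ ⟨π, rfl⟩
    exact G.payoffInf_le π σ p.1 p.2 hβ

theorem upperValueInf_le_mul_upperValue (hβ : G.β < 1) (n : ℕ) (p : E × Ioc (0 : ℝ) G.γbar) :
    G.upperValueInf p ≤
      Real.exp (p.2 * G.β ^ n * (G.rbar / (1 - G.β))) * G.upperValue n p := by
  rw [upperValue, Real.mul_iInf_of_nonneg (Real.exp_pos _).le]
  simp only [Real.mul_iSup_of_nonneg (Real.exp_pos _).le]
  refine ciInf_mono ⟨0, ?_⟩ fun σ => ciSup_mono
    ⟨Real.exp (p.2 * G.β ^ n * (G.rbar / (1 - G.β))) * Real.exp (p.2 * (G.rbar / (1 - G.β))), ?_⟩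
    fun π => G.payoffInf_le_mul_payoff π σ p.1 p.2 hβ n
  · rintro _ ⟨σ, rfl⟩
    exact Real.iSup_nonneg fun π => zero_le_one.trans (G.one_le_payoffInf π σ p.1 p.2 hβ)
  · rintro _ ⟨π, rfl⟩
    exact mul_le_mul_of_nonneg_left ((G.payoff_le_payoffInf π σ p.1 p.2 hβ n).trans
      (G.payoffInf_le π σ p.1 p.2 hβ)) (Real.exp_pos _).le

/-- Truncating the reward after `n` stages changes every payoff by a factor between `1` and
`exp(γ βⁿ rbar/(1-β))`, whatever the policies, so the upper values converge uniformly. -/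
theorem tendstoUniformly_upperValue (hβ : G.β < 1) {K : ℝ} (hK : ∀ p, G.upperValueInf p ≤ K) :
    TendstoUniformly G.upperValue G.upperValueInf atTop := by
  rw [Metric.tendstoUniformly_iff]
  intro ε hε
  set R := |G.rbar / (1 - G.β)|
  have hlim : Tendsto (fun n : ℕ => (Real.exp (G.γbar * G.β ^ n * R) - 1) * |K|) atTop
      (𝓝 ((Real.exp (G.γbar * 0 * R) - 1) * |K|)) :=
    (((Real.continuous_exp.tendsto _).comp (((tendsto_pow_atTop_nhds_zero_of_lt_one G.β_pos.le
      hβ).const_mul _).mul_const _)).sub_const 1).mul_const _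
  rw [mul_zero, zero_mul, Real.exp_zero, sub_self, zero_mul] at hlim
  filter_upwards [hlim.eventually_lt_const hε] with n hn p
  refine lt_of_le_of_lt ?_ hn
  have h1 := G.upperValue_le_upperValueInf hβ n p
  have h2 := G.upperValueInf_le_mul_upperValue hβ n p
  have h0 : 0 ≤ G.upperValue n p := Real.iInf_nonneg fun σ =>
    Real.iSup_nonneg fun π => G.payoff_nonneg π σ p.1 p.2 n
  have hc : Real.exp (p.2 * G.β ^ n * (G.rbar / (1 - G.β))) ≤ Real.exp (G.γbar * G.β ^ n * R) := by
    have hpow := pow_nonneg G.β_pos.le n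
    refine Real.exp_le_exp.2 ((mul_le_mul_of_nonneg_left (le_abs_self _)
      (mul_nonneg p.2.2.1.le hpow)).trans ?_)
    exact mul_le_mul_of_nonneg_right (mul_le_mul_of_nonneg_right p.2.2.2 hpow) (abs_nonneg _)
  have h1c : 1 ≤ Real.exp (G.γbar * G.β ^ n * R) := Real.one_le_exp
    (mul_nonneg (mul_nonneg G.γbar_pos.le (pow_nonneg G.β_pos.le n)) (abs_nonneg _))
  rw [Real.dist_eq, abs_of_nonneg (sub_nonneg.2 h1)]
  have h3 := mul_le_mul_of_nonneg_right hc h0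
  have h4 : (Real.exp (G.γbar * G.β ^ n * R) - 1) * G.upperValue n p ≤
      (Real.exp (G.γbar * G.β ^ n * R) - 1) * |K| :=
    mul_le_mul_of_nonneg_left ((h1.trans (hK p)).trans (le_abs_self K)) (sub_nonneg.2 h1c)
  linarith

end

/-! ### Solutions of the Shapley equation are values -/

section

variable {E A B : Type*}
    [TopologicalSpace E] [TopologicalSpace.MetrizableSpace E] [SecondCountableTopology E]
    [MeasurableSpace E] [BorelSpace E]
    [TopologicalSpace A] [TopologicalSpace.MetrizableSpace A] [SecondCountableTopology A]
    [MeasurableSpace A] [BorelSpace A]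
    [TopologicalSpace B] [TopologicalSpace.MetrizableSpace B] [SecondCountableTopology B]
    [MeasurableSpace B] [BorelSpace B]
    {G : RSGame E A B}

/-- One-stage saddle points for a bounded solution of the Shapley equation form a saddle point of
the infinite horizon game. -/
theorem IsSaddleSelector.isSaddle_payoffInf (hG : G.ContinuityCompactness) (hβ : G.β < 1)
    {v : BoundedContinuousFunction (E × Ioc (0 : ℝ) G.γbar) ℝ} (hT : ∀ p, G.T v p = v p)
    (hv : ∀ p, 1 ≤ v p ∧ v p ≤ Real.exp (p.2 * (G.rbar / (1 - G.β))))
    {μ : RSGame.Selector G.γbar G.actA} {ν : RSGame.Selector G.γbar G.actB}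
    (h : G.IsSaddleSelector v μ ν) (p : E × Ioc (0 : ℝ) G.γbar) :
    IsSaddle univ univ (fun π σ => G.payoffInf π σ p) (G.policyA μ p.2) (G.policyB ν p.2) ∧
      G.payoffInf (G.policyA μ p.2) (G.policyB ν p.2) p = v p := by
  have hval : ∀ q, G.L v q (μ.1 q) (ν.1 q) = v q := fun q =>
    (T_eq_of_isSaddle hG (h q)).symm.trans (hT q)
  have hle : ∀ π, G.payoffInf π (G.policyB ν p.2) p ≤ v p := by
    intro π
    refine payoffInf_le_of_forall_L_le hG hβ (fun q => (hv q).1) (fun n y => ?_) p.1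
    exact ((h (y, G.discount n p.2)).2.2.1 _ ((π n).2.2 y)).trans (hval (y, G.discount n p.2)).le
  have hge : ∀ σ, v p ≤ G.payoffInf (G.policyA μ p.2) σ p := by
    intro σ
    refine le_payoffInf_of_forall_le_L hG hβ (fun q => (hv q).1) (fun q => (hv q).2)
      (fun n y => ?_) p.1
    exact (hval (y, G.discount n p.2)).ge.trans ((h (y, G.discount n p.2)).2.2.2 _ ((σ n).2.2 y))
  exact ⟨⟨mem_univ _, mem_univ _, fun π _ => (hle π).trans (hge _),
    fun σ _ => (hle _).trans (hge σ)⟩, le_antisymm (hle _) (hge _)⟩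

/-- A bounded solution of the Shapley equation is both the upper and the lower value. -/
theorem values_eq_of_T_eq_self (hG : G.ContinuityCompactness) (hβ : G.β < 1)
    {v : BoundedContinuousFunction (E × Ioc (0 : ℝ) G.γbar) ℝ} (hT : ∀ p, G.T v p = v p)
    (hv : ∀ p, 1 ≤ v p ∧ v p ≤ Real.exp (p.2 * (G.rbar / (1 - G.β)))) :
    G.upperValueInf = v ∧ G.lowerValueInf = v := by
  obtain ⟨μ, ν, h⟩ := exists_isSaddleSelector hG v
  have hb : ∀ p : E × Ioc (0 : ℝ) G.γbar, ∀ (π : Policy G.actA) (σ : Policy G.actB),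
      |G.payoffInf π σ p| ≤ Real.exp (p.2 * (G.rbar / (1 - G.β))) := fun p π σ => by
    rw [abs_of_nonneg (zero_le_one.trans (G.one_le_payoffInf π σ p.1 p.2 hβ))]
    exact G.payoffInf_le π σ p.1 p.2 hβ
  constructor
  · funext p
    obtain ⟨h1, h2⟩ := h.isSaddle_payoffInf hG hβ hT hv p
    exact (h1.iInf_iSup_eq (F := id) (G := id) range_id range_id (hb p)).trans h2
  · funext p
    obtain ⟨h1, h2⟩ := h.isSaddle_payoffInf hG hβ hT hv p
    exact (h1.iSup_iInf_eq (F := id) (G := id) range_id range_id (hb p)).trans h2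

end

end RSGame

theorem mainTheorem2 {E A B : Type*}
    [TopologicalSpace E] [TopologicalSpace.MetrizableSpace E] [SecondCountableTopology E]
    [MeasurableSpace E] [BorelSpace E] [StandardBorelSpace E]
    [TopologicalSpace A] [TopologicalSpace.MetrizableSpace A] [SecondCountableTopology A]
    [MeasurableSpace A] [BorelSpace A] [StandardBorelSpace A]
    [TopologicalSpace B] [TopologicalSpace.MetrizableSpace B] [SecondCountableTopology B]
    [MeasurableSpace B] [BorelSpace B] [StandardBorelSpace B]
    (G : RSGame E A B) (hG : G.ContinuityCompactness) (hβ : G.β < 1) :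
    -- the upper value is the uniform limit of the finite horizon upper values
    TendstoUniformly G.upperValue G.upperValueInf atTop ∧
    -- the upper value is continuous and lies between the two bounds
    Continuous G.upperValueInf ∧
    (∀ p, 1 ≤ G.upperValueInf p ∧
      G.upperValueInf p ≤ Real.exp (p.2 * (G.rbar / (1 - G.β)))) ∧
    -- the Shapley equation
    (∀ p, G.upperValueInf p = G.T G.upperValueInf p ∧
      G.T G.upperValueInf p = ⨅ ν : probOn (G.actB p.1), ⨆ μ : probOn (G.actA p.1),
        G.L G.upperValueInf p μ ν) ∧
    -- uniqueness
    (∀ v : E × Ioc (0 : ℝ) G.γbar → ℝ, Continuous v →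
      (∀ p, 1 ≤ v p ∧ v p ≤ Real.exp (p.2 * (G.rbar / (1 - G.β)))) →
      (∀ p, v p = G.T v p) → v = G.upperValueInf) ∧
    -- existence of measurable saddle point selectors
    (∃ (μ : RSGame.Selector G.γbar G.actA) (ν : RSGame.Selector G.γbar G.actB),
      G.IsSaddleSelector G.upperValueInf μ ν) ∧
    -- the upper value is the value of the game
    G.upperValueInf = G.lowerValueInf ∧
    -- saddle point selectors yield optimal policies
    (∀ (μ : RSGame.Selector G.γbar G.actA) (ν : RSGame.Selector G.γbar G.actB),
      G.IsSaddleSelector G.upperValueInf μ ν →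
      ∀ γ : Ioc (0 : ℝ) G.γbar,
        G.IsOptimal₁ γ (G.policyA μ γ) ∧ G.IsOptimal₂ γ (G.policyB ν γ)) := by
  have hR : ∀ p : E × Ioc (0 : ℝ) G.γbar, Real.exp (p.2 * (G.rbar / (1 - G.β))) ≤
      Real.exp (G.γbar * |G.rbar / (1 - G.β)|) := fun p =>
    Real.exp_le_exp.2 ((mul_le_mul_of_nonneg_left (le_abs_self _) p.2.2.1.le).trans
      (mul_le_mul_of_nonneg_right p.2.2.2 (abs_nonneg _)))
  obtain ⟨v, hT, hv⟩ := RSGame.exists_T_eq_self hG hβ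
  obtain ⟨hup, hlow⟩ := RSGame.values_eq_of_T_eq_self hG hβ hT hv
  obtain ⟨μ, ν, hμν⟩ := RSGame.exists_isSaddleSelector hG v
  have hunif := G.tendstoUniformly_upperValue hβ
    (K := Real.exp (G.γbar * |G.rbar / (1 - G.β)|))
    (fun p => by rw [hup]; exact (hv p).2.trans (hR p))
  refine ⟨hunif, ?_⟩
  rw [hup, hlow]
  refine ⟨v.continuous, hv, fun p => ⟨(hT p).symm, RSGame.T_eq_iInf_iSup hG v p⟩, ?_,
    ⟨μ, ν, hμν⟩, rfl, ?_⟩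
  · intro w hw hwb hwT
    -- the bounds make `w` bounded, so `w` is a value as well
    let w' : BoundedContinuousFunction (E × Ioc (0 : ℝ) G.γbar) ℝ :=
      BoundedContinuousFunction.ofNormedAddCommGroup w hw
        (Real.exp (G.γbar * |G.rbar / (1 - G.β)|)) fun p => by
          rw [Real.norm_eq_abs, abs_of_nonneg (zero_le_one.trans (hwb p).1)]
          exact (hwb p).2.trans (hR p)
    have h := (RSGame.values_eq_of_T_eq_self hG hβ (v := w') (fun p => (hwT p).symm) hwb).1
    exact h.symm.trans hup
  · intro μ ν h γ
    have key := fun x => h.isSaddle_payoffInf hG hβ hT hv (x, γ)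
    refine ⟨fun x σ => ?_, fun x π => ?_⟩
    · rw [hlow, ← (key x).2]
      exact (key x).1.2.2.2 σ (mem_univ _)
    · rw [hup, ← (key x).2]
      exact (key x).1.2.2.1 π (mem_univ _)
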